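/- Let $\rho_0,\rho_1$ be probability measures on $\mathbb{R}^d$ that are absolutely continuous with respect to Lebesgue measure, and let $c:\mathbb{R}^d\times\mathbb{R}^d\to[0,\infty)$ be continuous with $c(x,y)=0$ if and only if $x=y$. Suppose that for some $p\ge 1$ and some constants $A,B>0$ one has $c(x,y)\le A+B(|x|^p+|y|^p)$ whenever $|x|$ and $|y|$ are both sufficiently large, and that $\rho_0,\rho_1$ have finite $p$-th moments. Let $\varepsilon>0$ and let $\mu_\varepsilon$ be the static Schrödinger bridge from $\rho_0$ to $\rho_1$ at temperature $\varepsilon$ with Schrödinger potentials $a_\varepsilon,b_\varepsilon$; that is, $a_\varepsilon,b_\varepsilon:\mathbb{R}^d\to\mathbb{R}$ are measurable and $$\mu_\varepsilon(dx\,dy)=\xi(x,y)\,\rho_0(dx)\,\rho_1(dy),\qquad \xi(x,y)=\exp\Big(-\tfrac1\varepsilon\big(c(x,y)-a_\varepsilon(x)-b_\varepsilon(y)\big)\Big),$$ is a probability measure with marginals $\rho_0$ and $\rho_1$. Assume that $a_\varepsilon\in L^1(\rho_0)$, $b_\varepsilon\in L^1(\rho_1)$ and $\xi\in L^2(\rho_0\otimes\rho_1)$.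 Let $\mathcal{A}:L^2(\rho_0)\to L^2(\rho_1)$ be the operator $(\mathcal{A}f)(y)=\int f(x)\,\xi(x,y)\,\rho_0(dx)$, with adjoint $\mathcal{A}^*$. Assume that $\mathcal{A}$ is compact and that $\mathcal{A}^*\mathcal{A}$ and $\mathcal{A}\mathcal{A}^*$ have a positive eigenvalue gap: there is $r<1$ such that every eigenvalue of $\mathcal{A}^*\mathcal{A}$ (respectively $\mathcal{A}\mathcal{A}^*$) with an eigenfunction orthogonal to the constant function $\mathbf 1$ in $L^2(\rho_0)$ (respectively $L^2(\rho_1)$) is at most $r$. On the space $(\mathbb{R}^d\times\mathbb{R}^d)^{\mathbb N}$ of sequences $(X_i,Y_i)_{i\ge1}$, let $P^\infty$ be the law under which the pairs $(X_i,Y_i)$ are i.i.d. with law $\rho_0\otimes\rho_1$, and $Q^\infty$ the law under which they are i.i.d. with law $\mu_\varepsilon$. Let $\widehat\rho_0^N=\frac1N\sum_{i=1}^N\delta_{X_i}$ and $\widehat\rho_1^N=\frac1N\sum_{i=1}^N\delta_{Y_i}$, let $\mathcal{G}_N$ be the $\sigma$-algebra generated by $(\widehat\rho_0^N,\widehat\rho_1^N)$,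 and let $R^N$ and $S^N$ be the laws of $(\widehat\rho_0^N,\widehat\rho_1^N)$ under $P^\infty$ and $Q^\infty$, respectively. Then $(R^N)_{N\ge1}$ is contiguous with respect to $(S^N)_{N\ge1}$: for all measurable sets $B_N$ of pairs of measures, $S^N(B_N)\to0$ implies $R^N(B_N)\to0$. Explicitly, for every sequence of events $A_N\in\mathcal{G}_N$ with $\lim_{N\to\infty}Q^\infty(A_N)=0$ one has $\lim_{N\to\infty}P^\infty(A_N)=0$. -/

import Mathlib

open MeasureTheory Filter Topology
open scoped ENNReal

noncomputable section

section KernelOperators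

variable {α β : Type*} [MeasurableSpace α] [MeasurableSpace β]
  {μ : Measure α} {ν : Measure β} [IsProbabilityMeasure μ] [IsProbabilityMeasure ν]

/-- The function `y ↦ ∫ f(x) k(x, y) μ(dx)`. -/
def kernelIntegral (μ : Measure α) (k : α × β → ℝ) (f : α → ℝ) (y : β) : ℝ :=
  ∫ x, f x * k (x, y) ∂μ

theorem eLpNorm_kernelIntegral_le {k : α × β → ℝ} (hk : MemLp k 2 (μ.prod ν)) {f : α → ℝ}
    (hf : MemLp f 2 μ) :
    eLpNorm (kernelIntegral μ k f) 2 ν ≤ eLpNorm k 2 (μ.prod ν) * eLpNorm f 2 μ := by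
  have hk' : AEStronglyMeasurable (fun z : β × α => k z.swap) (ν.prod μ) := hk.1.prod_swap
  have key : ∀ᵐ y ∂ν, ‖kernelIntegral μ k f y‖ₑ ^ (2 : ℝ) ≤
      (∫⁻ x, ‖f x‖ₑ ^ (2 : ℝ) ∂μ) * ∫⁻ x, ‖k (x, y)‖ₑ ^ (2 : ℝ) ∂μ := by
    filter_upwards [hk'.prodMk_left] with y hy
    have h1 : ‖kernelIntegral μ k f y‖ₑ ≤ ∫⁻ x, ‖f x‖ₑ * ‖k (x, y)‖ₑ ∂μ := by
      refine (enorm_integral_le_lintegral_enorm _).trans (le_of_eq ?_)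
      simp only [enorm_mul]
    have h2 := ENNReal.lintegral_mul_le_Lp_mul_Lq μ Real.HolderConjugate.two_two
      hf.1.enorm hy.enorm
    have h3 := h1.trans h2
    calc ‖kernelIntegral μ k f y‖ₑ ^ (2 : ℝ)
        ≤ _ := ENNReal.rpow_le_rpow h3 (by norm_num)
      _ = _ := by
        rw [ENNReal.mul_rpow_of_nonneg _ _ (by norm_num), ← ENNReal.rpow_mul,
          ← ENNReal.rpow_mul]
        norm_num
  have hint : ∫⁻ y, ∫⁻ x, ‖k (x, y)‖ₑ ^ (2 : ℝ) ∂μ ∂ν = ∫⁻ z, ‖k z‖ₑ ^ (2 : ℝ) ∂(μ.prod ν) :=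
    (lintegral_prod_symm _ (hk.1.enorm.pow_const _)).symm
  have hf2 : ∫⁻ x, ‖f x‖ₑ ^ (2 : ℝ) ∂μ ≠ ∞ := by
    have := lintegral_rpow_enorm_lt_top_of_eLpNorm_lt_top (p := 2) (by norm_num) (by norm_num) hf.2
    simpa using this.ne
  rw [eLpNorm_eq_lintegral_rpow_enorm_toReal (by norm_num) (by norm_num),
    eLpNorm_eq_lintegral_rpow_enorm_toReal (by norm_num) (by norm_num),
    eLpNorm_eq_lintegral_rpow_enorm_toReal (by norm_num) (by norm_num)]
  simp only [ENNReal.toReal_ofNat]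
  rw [← ENNReal.mul_rpow_of_nonneg _ _ (by norm_num)]
  refine ENNReal.rpow_le_rpow ?_ (by norm_num)
  refine (lintegral_mono_ae key).trans ?_
  rw [lintegral_const_mul' _ _ hf2, hint, mul_comm]

theorem memLp_kernelIntegral {k : α × β → ℝ} (hk : MemLp k 2 (μ.prod ν)) {f : α → ℝ}
    (hf : MemLp f 2 μ) : MemLp (kernelIntegral μ k f) 2 ν := by
  refine ⟨?_, (eLpNorm_kernelIntegral_le hk hf).trans_lt (ENNReal.mul_lt_top hk.2 hf.2)⟩
  have h : AEStronglyMeasurable (fun z : β × α => f z.2 * k z.swap) (ν.prod μ) :=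
    hf.1.comp_snd.mul hk.1.prod_swap
  exact h.integral_prod_right'

theorem ae_integrable_kernel {k : α × β → ℝ} (hk : MemLp k 2 (μ.prod ν)) {f : α → ℝ}
    (hf : MemLp f 2 μ) : ∀ᵐ y ∂ν, Integrable (fun x => f x * k (x, y)) μ := by
  have h2 : MemLp (fun z : β × α => k z.swap) 2 (ν.prod μ) :=
    hk.comp_measurePreserving Measure.measurePreserving_swap
  have h1 : MemLp (fun z : β × α => f z.2) 2 (ν.prod μ) :=
    hf.comp_measurePreserving measurePreserving_snd
  exact (h1.integrable_mul h2).prod_right_ae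

/-- The bounded operator `L²(μ) → L²(ν)`, `f ↦ (y ↦ ∫ f(x) k(x, y) μ(dx))`,
with square integrable kernel `k`. -/
def kernelOperator (k : α × β → ℝ) (hk : MemLp k 2 (μ.prod ν)) :
    Lp ℝ 2 μ →L[ℝ] Lp ℝ 2 ν :=
  LinearMap.mkContinuous
    { toFun := fun f => (memLp_kernelIntegral hk (Lp.memLp f)).toLp (kernelIntegral μ k f)
      map_add' := by
        intro f g
        rw [← MemLp.toLp_add]
        refine MemLp.toLp_congr _ _ ?_
        filter_upwards [ae_integrable_kernel hk (Lp.memLp f),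
          ae_integrable_kernel hk (Lp.memLp g)] with y hf hg
        simp only [kernelIntegral, Pi.add_apply]
        rw [← integral_add hf hg]
        refine integral_congr_ae ?_
        filter_upwards [Lp.coeFn_add f g] with x hx
        rw [hx, Pi.add_apply, add_mul]
      map_smul' := by
        intro r f
        rw [RingHom.id_apply, ← MemLp.toLp_const_smul]
        refine MemLp.toLp_congr _ _ (Eventually.of_forall fun y => ?_)
        simp only [kernelIntegral, Pi.smul_apply, smul_eq_mul]
        rw [← integral_const_mul]
        refine integral_congr_ae ?_
        filter_upwards [Lp.coeFn_smul r f] with x hx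
        rw [hx, Pi.smul_apply, smul_eq_mul, mul_assoc] }
    (eLpNorm k 2 (μ.prod ν)).toReal
    (by
      intro f
      change ‖(memLp_kernelIntegral hk (Lp.memLp f)).toLp (kernelIntegral μ k f)‖ ≤ _
      rw [Lp.norm_toLp, Lp.norm_def, ← ENNReal.toReal_mul]
      exact ENNReal.toReal_mono (ENNReal.mul_lt_top hk.2 (Lp.memLp f).2).ne
        (eLpNorm_kernelIntegral_le hk (Lp.memLp f)))

theorem kernelOperator_ae_eq (k : α × β → ℝ) (hk : MemLp k 2 (μ.prod ν)) (f : Lp ℝ 2 μ) :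
    kernelOperator k hk f =ᵐ[ν] fun y => ∫ x, f x * k (x, y) ∂μ :=
  MemLp.coeFn_toLp (memLp_kernelIntegral hk (Lp.memLp f))

/-- The operator `T` has an eigenvalue gap below the eigenvalue of the vector `e`: for some
`r < 1`, every eigenvalue of `T` that has an eigenvector orthogonal to `e` is at most `r`. -/
def HasEigenvalueGap {H : Type*} [NormedAddCommGroup H] [InnerProductSpace ℝ H]
    (T : H →L[ℝ] H) (e : H) : Prop :=
  ∃ r : ℝ, r < 1 ∧ ∀ (t : ℝ) (f : H), f ≠ 0 → inner ℝ e f = 0 → T f = t • f → t ≤ r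

end KernelOperators

section Bridge

variable {E : Type*} [MeasurableSpace E]

/-- `ξ(x, y) = exp (-(c(x, y) - a(x) - b(y)) / ε)`. -/
def bridgeDensity (c : E → E → ℝ) (ε : ℝ) (a b : E → ℝ) (z : E × E) : ℝ :=
  Real.exp (-(1 / ε) * (c z.1 z.2 - a z.1 - b z.2))

/-- `μ` is the static Schrödinger bridge from `ρ₀` to `ρ₁` at temperature `ε` for the cost `c`,
with Schrödinger potentials `a`, `b`: it is a coupling of `ρ₀` and `ρ₁`, of the form
`μ(dx dy) = ξ(x, y) ρ₀(dx) ρ₁(dy)`. -/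
structure IsSchrodingerBridge (c : E → E → ℝ) (ε : ℝ) (ρ₀ ρ₁ : Measure E) (a b : E → ℝ)
    (μ : Measure (E × E)) : Prop where
  measurable_left : Measurable a
  measurable_right : Measurable b
  eq_withDensity :
    μ = (ρ₀.prod ρ₁).withDensity fun z => ENNReal.ofReal (bridgeDensity c ε a b z)
  fst_eq : μ.fst = ρ₀
  snd_eq : μ.snd = ρ₁

end Bridge

section Empirical

variable {E : Type*} [MeasurableSpace E]

/-- The pair `(N⁻¹ ∑_{i < N} δ_{X_i}, N⁻¹ ∑_{i < N} δ_{Y_i})` of marginal empirical distributions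
of the first `N` terms of a sequence of pairs `ω i = (X_i, Y_i)`. -/
def empiricalPair (N : ℕ) (ω : ℕ → E × E) : Measure E × Measure E :=
  ((N : ℝ≥0∞)⁻¹ • ∑ i ∈ Finset.range N, Measure.dirac (ω i).1,
    (N : ℝ≥0∞)⁻¹ • ∑ i ∈ Finset.range N, Measure.dirac (ω i).2)

theorem measurable_empiricalPair (N : ℕ) :
    Measurable (empiricalPair N : (ℕ → E × E) → Measure E × Measure E) := by
  refine Measurable.prodMk ?_ ?_ <;>
  · refine Measure.measurable_of_measurable_coe _ fun s hs => ?_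
    simp only [Measure.smul_apply, Measure.coe_finsetSum, Finset.sum_apply, smul_eq_mul,
      Measure.dirac_apply' _ hs]
    refine Measurable.const_mul (Finset.measurable_sum _ fun i _ => ?_) _
    exact (measurable_one.indicator hs).comp (by fun_prop)

/-- The σ-algebra on the sequence space generated by the pair of marginal empirical
distributions of the first `N` terms. -/
@[reducible] def empiricalSigma (E : Type*) [MeasurableSpace E] (N : ℕ) : MeasurableSpace (ℕ → E × E) :=
  MeasurableSpace.comap (empiricalPair N) inferInstance

/-- The law of an infinite i.i.d. sequence with common law `π`. -/
def iidLaw (π : Measure (E × E)) : Measure (ℕ → E × E) :=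
  Measure.infinitePi fun _ : ℕ => π

/-- The law of the pair of marginal empirical distributions of `N` i.i.d. pairs of law `π`. -/
def empiricalPairLaw (π : Measure (E × E)) (N : ℕ) : Measure (Measure E × Measure E) :=
  (iidLaw π).map (empiricalPair N)

/-- The sequence of measures `R` is contiguous with respect to the sequence `S`. -/
def IsContiguous {Ω : ℕ → Type*} [∀ N, MeasurableSpace (Ω N)] (R S : ∀ N, Measure (Ω N)) : Prop :=
  ∀ A : ∀ N, Set (Ω N), (∀ N, MeasurableSet (A N)) →
    Tendsto (fun N => S N (A N)) atTop (𝓝 0) → Tendsto (fun N => R N (A N)) atTop (𝓝 0)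

end Empirical

end

/-! The empirical measures forget how the two samples are paired. On events invariant under
permutations of the second sample, the bridge law therefore has density `pairingAverage`, L_N =
(1/N!) ∑_σ ∏ ξ(X_i, Y_σ(i)), with respect to the product law (`lintegral_symmetric_mul_prod`).
Contiguity amounts to L_N not being small on events of non-negligible product probability. This is
shown by comparing L_N in mean square with a positive function of a CLT statistic.

Since both marginals of the bridge are prescribed, the operator of kernel ξ fixes the constants, and
by the gap and Parseval ξ = 1 + ∑ s_i φ_i ψ_i in L², with s_i² ≤ r < 1 and ∑ s_i² finite
(`exists_isSingularSystem`). Expanding L_N along this decomposition and counting permutations gives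
E L_N² ≤ C = ∏ (1 - s_i²)⁻¹ for every N (`IsSingularSystem.integral_pairingAverage_sq_le`).

For a finite set K of indices, let Z_N be the normalized sums of φ_i and ψ_i, i ∈ K. By the central
limit theorem Z_N converges to independent standard Gaussian pairs under the product law, and to
pairs with correlations s_i under the bridge law. The density F between the two limits is a product
of Mehler kernels, with ∫ F² = ∏_{i ∈ K} (1 - s_i²)⁻¹, close to C for K large. For a truncation H =
min(F, M), E (H(Z_N) - L_N)² = E H(Z_N)² - 2 E_Q H(Z_N) + E L_N² has upper limit at most ∫ H² - 2 ∫
F H + C ≤ C - ∫ H², which is small. No limit theorem for L_N itself is needed.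

Finally E(-log F) ≤ ∑ s_i² / (1 - s_i²) is bounded uniformly in K, so F is rarely close to 0
(`measureReal_mehlerProd_le`). Where F(Z_N) > η, the indicator of an event B is at most η⁻¹ (L_N +
|H(Z_N) - L_N|) 1_B, and E L_N 1_B = Q(B) → 0. These estimates are combined in
`IsSingularSystem.tendsto_measureReal_zero`. -/

section ProductMeasures

/-! ### Densities and permutations of finite product measures. -/

variable {ι : Type*} [Fintype ι] {X : ι → Type*} [∀ i, MeasurableSpace (X i)]

theorem lintegral_pi_prod (μ : ∀ i, Measure (X i)) [∀ i, IsProbabilityMeasure (μ i)]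
    {f : ∀ i, X i → ℝ≥0∞} (hf : ∀ i, Measurable (f i)) :
    ∫⁻ x, ∏ i, f i (x i) ∂Measure.pi μ = ∏ i, ∫⁻ x, f i x ∂μ i := by
  have h := ProbabilityTheory.iIndepFun_pi (μ := μ) (X := fun i => f i)
    (fun i => (hf i).aemeasurable)
  have := ProbabilityTheory.lintegral_prod_eq_prod_lintegral_of_indepFun Finset.univ
    (fun i (x : ∀ i, X i) => f i (x i)) h (fun i => by fun_prop)
  rw [this]
  refine Finset.prod_congr rfl fun i _ => ?_
  exact (measurePreserving_eval μ i).lintegral_comp (hf i)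

theorem pi_withDensity (μ : ∀ i, Measure (X i)) [∀ i, IsProbabilityMeasure (μ i)]
    {f : ∀ i, X i → ℝ≥0∞} (hf : ∀ i, Measurable (f i))
    [∀ i, SigmaFinite ((μ i).withDensity (f i))] :
    Measure.pi (fun i => (μ i).withDensity (f i)) =
      (Measure.pi μ).withDensity fun x => ∏ i, f i (x i) := by
  refine (Measure.pi_eq fun s hs => ?_)
  rw [withDensity_apply _ (MeasurableSet.univ_pi hs),
    ← lintegral_indicator (MeasurableSet.univ_pi hs)]
  have : ∀ x : ∀ i, X i, (Set.univ.pi s).indicator (fun x => ∏ i, f i (x i)) x =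
      ∏ i, (s i).indicator (f i) (x i) := by
    intro x
    by_cases hx : x ∈ Set.univ.pi s
    · rw [Set.indicator_of_mem hx]
      exact Finset.prod_congr rfl fun i _ => (Set.indicator_of_mem (hx i trivial) _).symm
    · rw [Set.indicator_of_notMem hx]
      simp only [Set.mem_pi, Set.mem_univ, true_imp_iff, not_forall] at hx
      obtain ⟨i, hi⟩ := hx
      exact (Finset.prod_eq_zero (Finset.mem_univ i) (Set.indicator_of_notMem hi _)).symm
  simp_rw [this]
  rw [lintegral_pi_prod μ fun i => (hf i).indicator (hs i)]
  refine Finset.prod_congr rfl fun i _ => ?_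
  rw [lintegral_indicator (hs i), withDensity_apply _ (hs i)]

theorem measurePreserving_comp_perm {α ι : Type*} [Fintype ι] [MeasurableSpace α] (μ : Measure α)
    [IsProbabilityMeasure μ] (σ : Equiv.Perm ι) :
    MeasurePreserving (fun x : ι → α => x ∘ σ) (Measure.pi fun _ => μ) (Measure.pi fun _ => μ) := by
  have h := (measurePreserving_piCongrLeft (fun _ : ι => μ) σ).symm
  exact h

end ProductMeasures

/-! ### The density of the bridge law on permutation-invariant functions. -/

section SplitSample

variable {E : Type*} [MeasurableSpace E]

/-- The first and the second components of the first `N` terms of a sequence of pairs. -/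
def splitSample (N : ℕ) (ω : ℕ → E × E) : (Fin N → E) × (Fin N → E) :=
  (fun i => (ω i).1, fun i => (ω i).2)

theorem measurable_splitSample (N : ℕ) :
    Measurable (splitSample N : (ℕ → E × E) → (Fin N → E) × (Fin N → E)) := by
  unfold splitSample
  fun_prop

/-- The pair of empirical distributions of two samples of the same size. -/
noncomputable def empiricalOfSplit (N : ℕ) (z : (Fin N → E) × (Fin N → E)) :
    Measure E × Measure E :=
  ((N : ℝ≥0∞)⁻¹ • ∑ i, Measure.dirac (z.1 i), (N : ℝ≥0∞)⁻¹ • ∑ i, Measure.dirac (z.2 i))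

theorem empiricalPair_eq (N : ℕ) (ω : ℕ → E × E) :
    empiricalPair N ω = empiricalOfSplit N (splitSample N ω) := by
  simp only [empiricalPair, empiricalOfSplit, splitSample, Finset.sum_range]

theorem measurable_empiricalOfSplit (N : ℕ) :
    Measurable (empiricalOfSplit N : (Fin N → E) × (Fin N → E) → Measure E × Measure E) := by
  refine Measurable.prodMk ?_ ?_ <;>
  · refine Measure.measurable_of_measurable_coe _ fun s hs => ?_
    simp only [Measure.smul_apply, Measure.coe_finsetSum, Finset.sum_apply, smul_eq_mul,
      Measure.dirac_apply' _ hs]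
    refine Measurable.const_mul (Finset.measurable_sum _ fun i _ => ?_) _
    exact (measurable_one.indicator hs).comp (by fun_prop)

theorem empiricalOfSplit_perm (N : ℕ) (x y : Fin N → E) (σ : Equiv.Perm (Fin N)) :
    empiricalOfSplit N (x, y ∘ σ) = empiricalOfSplit N (x, y) := by
  simp only [empiricalOfSplit, Function.comp_apply]
  rw [Equiv.sum_comp σ fun i => Measure.dirac (y i)]

theorem map_iidLaw_fin (π : Measure (E × E)) [IsProbabilityMeasure π] (N : ℕ) :
    (iidLaw π).map (fun ω (i : Fin N) => ω i) = Measure.pi fun _ : Fin N => π := by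
  refine (Measure.pi_eq fun s hs => ?_).symm
  rw [Measure.map_apply (by fun_prop) (MeasurableSet.univ_pi hs)]
  -- The box over `Fin N` is a cylinder over `Finset.range N`; the value `Set.univ` beyond `N` is
  -- never read.
  have : (fun (ω : ℕ → E × E) (i : Fin N) => ω i) ⁻¹' Set.univ.pi s =
      Set.pi (Finset.range N) fun i => if h : i < N then s ⟨i, h⟩ else Set.univ := by
    ext ω
    simp only [Set.mem_preimage, Set.mem_pi, Set.mem_univ, true_imp_iff, Finset.coe_range,
      Set.mem_Iio]
    constructor
    · intro h i hi
      rw [dif_pos hi]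
      exact h ⟨i, hi⟩
    · intro h i
      have := h i i.2
      rwa [dif_pos i.2] at this
  rw [this, iidLaw, Measure.infinitePi_pi, Finset.prod_range]
  · refine Finset.prod_congr rfl fun i _ => ?_
    rw [dif_pos i.2]
  · intro i hi
    rw [dif_pos (Finset.mem_range.1 hi)]
    exact hs _

theorem map_splitSample (π : Measure (E × E)) [IsProbabilityMeasure π] (N : ℕ) :
    (iidLaw π).map (splitSample N) = (Measure.pi fun _ : Fin N => π).map
      (MeasurableEquiv.arrowProdEquivProdArrow E E (Fin N)) := by
  rw [← map_iidLaw_fin, Measure.map_map (MeasurableEquiv.measurable _) (by fun_prop)]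
  rfl

/-- The joint law of two independent samples of size `N`, of laws `μ` and `ν`. -/
noncomputable abbrev samplePair (μ ν : Measure E) (N : ℕ) :
    Measure ((Fin N → E) × (Fin N → E)) :=
  (Measure.pi fun _ => μ).prod (Measure.pi fun _ => ν)

theorem map_splitSample_prod (μ ν : Measure E) [IsProbabilityMeasure μ] [IsProbabilityMeasure ν]
    (N : ℕ) : (iidLaw (μ.prod ν)).map (splitSample N) = samplePair μ ν N := by
  rw [map_splitSample]
  exact (measurePreserving_arrowProdEquivProdArrow E E (Fin N) (fun _ => μ) (fun _ => ν)).map_eq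

theorem map_splitSample_withDensity (μ ν : Measure E) [IsProbabilityMeasure μ]
    [IsProbabilityMeasure ν] {f : E × E → ℝ≥0∞} (hf : Measurable f)
    [IsProbabilityMeasure ((μ.prod ν).withDensity f)] (N : ℕ) :
    (iidLaw ((μ.prod ν).withDensity f)).map (splitSample N) =
      (samplePair μ ν N).withDensity fun z => ∏ i, f (z.1 i, z.2 i) := by
  rw [map_splitSample, pi_withDensity (fun _ : Fin N => μ.prod ν) fun _ => hf]
  have hmp := measurePreserving_arrowProdEquivProdArrow E E (Fin N) (fun _ => μ) (fun _ => ν)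
  ext s hs
  unfold samplePair
  rw [Measure.map_apply (MeasurableEquiv.measurable _) hs,
    withDensity_apply _ ((MeasurableEquiv.measurable _) hs), withDensity_apply _ hs,
    ← hmp.map_eq, setLIntegral_map hs (by fun_prop) (MeasurableEquiv.measurable _)]
  rfl

/-- The average over the pairings of two samples of the product of the values of `k`. -/
noncomputable def pairingAverage (k : E × E → ℝ) (N : ℕ) (z : (Fin N → E) × (Fin N → E)) : ℝ :=
  (N.factorial : ℝ)⁻¹ * ∑ σ : Equiv.Perm (Fin N), ∏ i, k (z.1 i, z.2 (σ i))

theorem measurable_pairingAverage {k : E × E → ℝ} (hk : Measurable k) (N : ℕ) :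
    Measurable (pairingAverage k N) := by
  unfold pairingAverage
  fun_prop

theorem pairingAverage_nonneg {E : Type*} {k : E × E → ℝ} (hk : ∀ z, 0 ≤ k z) (N : ℕ)
    (z : (Fin N → E) × (Fin N → E)) : 0 ≤ pairingAverage k N z :=
  mul_nonneg (by positivity)
    (Finset.sum_nonneg fun _ _ => Finset.prod_nonneg fun _ _ => hk _)

theorem measurePreserving_samplePair_perm (μ ν : Measure E) [IsProbabilityMeasure μ]
    [IsProbabilityMeasure ν] (N : ℕ) (σ : Equiv.Perm (Fin N)) :
    MeasurePreserving (fun z : (Fin N → E) × (Fin N → E) => (z.1, z.2 ∘ σ))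
      (samplePair μ ν N) (samplePair μ ν N) :=
  (MeasurePreserving.id _).prod (measurePreserving_comp_perm ν σ)

/-- Reindexing the second sample changes neither the product law nor `G`, so every pairing of the
two samples gives the same integral, and the identity pairing may be replaced by the average over
all pairings. -/
theorem lintegral_symmetric_mul_prod (μ ν : Measure E) [IsProbabilityMeasure μ]
    [IsProbabilityMeasure ν] {k : E × E → ℝ} (hk : Measurable k) (hk0 : ∀ z, 0 ≤ k z) (N : ℕ)
    {G : (Fin N → E) × (Fin N → E) → ℝ≥0∞} (hG : Measurable G)
    (hsymm : ∀ x y (σ : Equiv.Perm (Fin N)), G (x, y ∘ σ) = G (x, y)) :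
    ∫⁻ z, G z * ∏ i, ENNReal.ofReal (k (z.1 i, z.2 i)) ∂samplePair μ ν N =
      ∫⁻ z, G z * ENNReal.ofReal (pairingAverage k N z) ∂samplePair μ ν N := by
  have h1 : ∀ σ : Equiv.Perm (Fin N),
      ∫⁻ z, G z * ∏ i, ENNReal.ofReal (k (z.1 i, z.2 (σ i))) ∂samplePair μ ν N =
      ∫⁻ z, G z * ∏ i, ENNReal.ofReal (k (z.1 i, z.2 i)) ∂samplePair μ ν N := by
    intro σ
    rw [← (measurePreserving_samplePair_perm μ ν N σ).lintegral_comp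
      (f := fun z => G z * ∏ i, ENNReal.ofReal (k (z.1 i, z.2 i))) (by fun_prop)]
    refine lintegral_congr fun z => ?_
    rw [hsymm]
    rfl
  have h2 : ∀ z, G z * ENNReal.ofReal (pairingAverage k N z) =
      ENNReal.ofReal (N.factorial : ℝ)⁻¹ *
        ∑ σ : Equiv.Perm (Fin N), G z * ∏ i, ENNReal.ofReal (k (z.1 i, z.2 (σ i))) := by
    intro z
    rw [pairingAverage, ENNReal.ofReal_mul (by positivity),
      ENNReal.ofReal_sum_of_nonneg fun _ _ => Finset.prod_nonneg fun _ _ => hk0 _,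
      ← Finset.mul_sum]
    simp_rw [ENNReal.ofReal_prod_of_nonneg fun i _ => hk0 _]
    ring
  simp_rw [h2]
  rw [lintegral_const_mul _ (by fun_prop), lintegral_finsetSum _ (fun _ _ => by fun_prop)]
  simp_rw [h1]
  rw [Finset.sum_const, Finset.card_univ, Fintype.card_perm, Fintype.card_fin, nsmul_eq_mul,
    ← mul_assoc, ← ENNReal.ofReal_natCast, ← ENNReal.ofReal_mul (by positivity),
    inv_mul_cancel₀ (by positivity), ENNReal.ofReal_one, one_mul]

end SplitSample

/-! ### Counting the permutations that carry one word to another. -/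

section PermutationCount

variable {J : Type*} [DecidableEq J] {N : ℕ}

/-- The number of permutations `σ` with `f ∘ σ = g`. -/
def permCount (f g : Fin N → J) : ℕ :=
  (Finset.univ.filter fun σ : Equiv.Perm (Fin N) => f ∘ σ = g).card

theorem permCount_comp_left (f g : Fin N → J) (τ : Equiv.Perm (Fin N)) :
    permCount (f ∘ τ) g = permCount f g := by
  refine Finset.card_equiv (Equiv.mulLeft τ) fun σ => ?_
  simp only [Finset.mem_filter, Finset.mem_univ, true_and, Equiv.coe_mulLeft, Equiv.Perm.coe_mul]
  rfl

theorem permCount_comp_right (f g : Fin N → J) (τ : Equiv.Perm (Fin N)) :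
    permCount f (g ∘ τ) = permCount f g := by
  symm
  refine Finset.card_equiv (Equiv.mulRight τ) fun σ => ?_
  simp only [Finset.mem_filter, Finset.mem_univ, true_and, Equiv.coe_mulRight, Equiv.Perm.coe_mul,
    ← Function.comp_assoc]
  exact (τ.surjective.injective_comp_right.eq_iff).symm

theorem sum_permCount [Fintype J] (f : Fin N → J) : ∑ g, permCount f g = N.factorial := by
  have h := Finset.card_eq_sum_card_fiberwise (s := (Finset.univ : Finset (Equiv.Perm (Fin N))))
    (t := Finset.univ) (f := fun σ : Equiv.Perm (Fin N) => f ∘ σ)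
    (fun _ _ => Finset.mem_coe.2 (Finset.mem_univ _))
  rw [Finset.card_univ, Fintype.card_perm, Fintype.card_fin] at h
  exact h.symm

theorem exists_perm_of_permCount_ne_zero {f g : Fin N → J} (h : permCount f g ≠ 0) :
    ∃ τ : Equiv.Perm (Fin N), g = f ∘ τ := by
  obtain ⟨τ, hτ⟩ := Finset.card_ne_zero.1 h
  exact ⟨τ, (Finset.mem_filter.1 hτ).2.symm⟩

/-- On the orbit of `f` the count is constant, equal to the order of the stabilizer `permCount f f`,
and it vanishes elsewhere; so one factor of the square can be pulled out of the sum. -/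
theorem sum_permCount_sq [Fintype J] (f : Fin N → J) :
    ∑ g, permCount f g ^ 2 = N.factorial * permCount f f := by
  rw [← sum_permCount f, Finset.sum_mul]
  refine Finset.sum_congr rfl fun g _ => ?_
  by_cases h : permCount f g = 0
  · simp [h]
  · obtain ⟨τ, rfl⟩ := exists_perm_of_permCount_ne_zero h
    rw [sq, permCount_comp_right]

theorem exists_perm_of_card_fiber_eq {f g : Fin N → J}
    (h : ∀ j, (Finset.univ.filter fun i => f i = j).card =
      (Finset.univ.filter fun i => g i = j).card) :
    ∃ τ : Equiv.Perm (Fin N), g = f ∘ τ := by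
  have e : ∀ j, Nonempty ({i // g i = j} ≃ {i // f i = j}) := fun j => by
    refine ⟨Fintype.equivOfCardEq ?_⟩
    rw [Fintype.card_subtype, Fintype.card_subtype, h]
  refine ⟨Equiv.ofFiberEquiv fun j => (e j).some, funext fun i => ?_⟩
  exact (Equiv.ofFiberEquiv_map (fun j => (e j).some) i).symm

/-- The number of letters `none` is what the other letters leave out of `N`, so it need not be
compared. -/
theorem exists_perm_of_card_fiber_some_eq {K : Type*} [Fintype K] [DecidableEq K]
    {f g : Fin N → Option K}
    (h : ∀ k, (Finset.univ.filter fun i => f i = some k).card =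
      (Finset.univ.filter fun i => g i = some k).card) :
    ∃ τ : Equiv.Perm (Fin N), g = f ∘ τ := by
  refine exists_perm_of_card_fiber_eq fun j => ?_
  have hsum : ∀ f : Fin N → Option K, N = (Finset.univ.filter fun i => f i = none).card +
      ∑ k, (Finset.univ.filter fun i => f i = some k).card := fun f => by
    have := Finset.card_eq_sum_card_fiberwise (s := (Finset.univ : Finset (Fin N)))
      (t := Finset.univ) (f := f) (fun _ _ => Finset.mem_coe.2 (Finset.mem_univ _))
    rw [Fintype.sum_option] at this
    simpa using this
  cases j with
  | some k => exact h k
  | none =>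
    have h1 := hsum f
    have h2 := hsum g
    rw [Finset.sum_congr rfl fun k _ => h k] at h1
    omega

/-- Words are grouped by the numbers of occurrences of the letters `some k`, which determine their
weight because `none` weighs 1. Each group lies in a single orbit and contributes at most `N!` times
its weight. Letting the counts vary independently then gives a product of geometric sums. -/
theorem sum_prod_mul_permCount_le {K : Type*} [Fintype K] [DecidableEq K] {q : Option K → ℝ}
    (hnone : q none = 1) (h0 : ∀ k, 0 ≤ q (some k)) (h1 : ∀ k, q (some k) < 1) :
    ∑ f : Fin N → Option K, (∏ i, q (f i)) * permCount f f ≤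
      N.factorial * ∏ k, (1 - q (some k))⁻¹ := by
  let cnt : (Fin N → Option K) → K → ℕ := fun f k => (Finset.univ.filter fun i => f i = some k).card
  have hcnt : ∀ f, cnt f ∈ Fintype.piFinset fun _ : K => Finset.range (N + 1) := fun f => by
    rw [Fintype.mem_piFinset]
    intro k
    rw [Finset.mem_range, Nat.lt_succ_iff]
    exact (Finset.card_filter_le _ _).trans (by simp)
  have hprod : ∀ f : Fin N → Option K, ∏ i, q (f i) = ∏ k, q (some k) ^ cnt f k := fun f => by
    rw [← Finset.prod_fiberwise_of_maps_to (s := Finset.univ) (t := Finset.univ) (g := f)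
      (fun _ _ => Finset.mem_univ _)]
    have : ∀ j, ∏ i with f i = j, q (f i) = q j ^ (Finset.univ.filter fun i => f i = j).card :=
      fun j => Finset.prod_eq_pow_card fun i hi => by rw [(Finset.mem_filter.1 hi).2]
    simp_rw [this]
    rw [Fintype.prod_option, hnone, one_pow, one_mul]
  have hq : ∀ k c, 0 ≤ q (some k) ^ c := fun k c => pow_nonneg (h0 k) c
  rw [← Finset.sum_fiberwise_of_maps_to (t := Fintype.piFinset fun _ : K => Finset.range (N + 1))
    (g := cnt) (fun f _ => hcnt f)]
  calc _ ≤ ∑ c ∈ Fintype.piFinset fun _ : K => Finset.range (N + 1),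
        (∏ k, q (some k) ^ c k) * N.factorial := by
        refine Finset.sum_le_sum fun c _ => ?_
        have : ∑ f with cnt f = c, (∏ i, q (f i)) * (permCount f f : ℝ) =
            (∏ k, q (some k) ^ c k) * ∑ f with cnt f = c, (permCount f f : ℝ) := by
          rw [Finset.mul_sum]
          refine Finset.sum_congr rfl fun f hf => ?_
          rw [hprod, (Finset.mem_filter.1 hf).2]
        rw [this]
        refine mul_le_mul_of_nonneg_left ?_ (Finset.prod_nonneg fun k _ => hq k _)
        rcases (Finset.univ.filter fun f => cnt f = c).eq_empty_or_nonempty with he | ⟨f₀, hf₀⟩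
        · rw [he, Finset.sum_empty]
          positivity
        -- With the same counts, `f` is a rearrangement of `f₀`, so the diagonal count becomes one
        -- based at `f₀`, whose sum over all words is `N!`.
        · have h2 : ∀ f ∈ Finset.univ.filter (fun f => cnt f = c),
              permCount f f = permCount f₀ f := fun f hf => by
            obtain ⟨τ, rfl⟩ := exists_perm_of_card_fiber_some_eq (f := f₀) (g := f) fun k =>
              congrFun ((Finset.mem_filter.1 hf₀).2.trans (Finset.mem_filter.1 hf).2.symm) k
            rw [permCount_comp_left]
          rw [← Nat.cast_sum, Nat.cast_le, Finset.sum_congr rfl h2, ← sum_permCount f₀]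
          exact Finset.sum_le_sum_of_subset (Finset.filter_subset _ _)
    _ = N.factorial * ∏ k, ∑ c ∈ Finset.range (N + 1), q (some k) ^ c := by
        rw [Finset.prod_univ_sum, ← Finset.sum_mul, mul_comm]
    _ ≤ _ := by
        refine mul_le_mul_of_nonneg_left ?_ (by positivity)
        refine Finset.prod_le_prod (fun k _ => Finset.sum_nonneg fun c _ => hq k c) fun k _ => ?_
        rw [← tsum_geometric_of_lt_one (h0 k) (h1 k)]
        exact (summable_geometric_of_lt_one (h0 k) (h1 k)).sum_le_tsum _ fun c _ => hq k c

end PermutationCount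

/-! ### The second moment of the pairing average for a kernel of finite rank. -/

section SecondMoment

theorem integral_sq_sum_of_orthonormal {Ω ι : Type*} [MeasurableSpace Ω] {P : Measure Ω} [Fintype ι]
    [DecidableEq ι] {h : ι → Ω → ℝ} (hint : ∀ a b, Integrable (fun ω => h a ω * h b ω) P)
    (horth : ∀ a b, ∫ ω, h a ω * h b ω ∂P = if a = b then 1 else 0) (c : ι → ℝ) :
    Integrable (fun ω => (∑ a, c a * h a ω) ^ 2) P ∧
    ∫ ω, (∑ a, c a * h a ω) ^ 2 ∂P = ∑ a, c a ^ 2 := by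
  have hexp : ∀ ω, (∑ a, c a * h a ω) ^ 2 = ∑ a, ∑ b, c a * c b * (h a ω * h b ω) := fun ω => by
    rw [sq, Finset.sum_mul_sum]
    exact Finset.sum_congr rfl fun a _ => Finset.sum_congr rfl fun b _ => by ring
  have hi : ∀ a b, Integrable (fun ω => c a * c b * (h a ω * h b ω)) P :=
    fun a b => (hint a b).const_mul _
  simp_rw [hexp]
  refine ⟨integrable_finsetSum _ fun a _ => integrable_finsetSum _ fun b _ => hi a b, ?_⟩
  rw [integral_finsetSum _ fun a _ => integrable_finsetSum _ fun b _ => hi a b]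
  refine Finset.sum_congr rfl fun a _ => ?_
  rw [integral_finsetSum _ fun b _ => hi a b]
  simp_rw [integral_const_mul, horth]
  simp [sq]

variable {E : Type*} [MeasurableSpace E] {μ ν : Measure E} [IsProbabilityMeasure μ]
  [IsProbabilityMeasure ν]

theorem integral_prod_comp_orthonormal {J : Type*} [DecidableEq J] {φ : J → E → ℝ}
    (hφ : ∀ i, MemLp (φ i) 2 μ)
    (horth : ∀ i j, ∫ x, φ i x * φ j x ∂μ = if i = j then 1 else 0) {N : ℕ} (f g : Fin N → J) :
    Integrable (fun x : Fin N → E => (∏ i, φ (f i) (x i)) * ∏ i, φ (g i) (x i))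
      (Measure.pi fun _ => μ) ∧
    ∫ x : Fin N → E, (∏ i, φ (f i) (x i)) * ∏ i, φ (g i) (x i) ∂(Measure.pi fun _ => μ) =
      if f = g then 1 else 0 := by
  simp_rw [← Finset.prod_mul_distrib]
  refine ⟨Integrable.fintype_prod (f := fun i x => φ (f i) x * φ (g i) x)
    fun i => (hφ _).integrable_mul (hφ _), ?_⟩
  rw [integral_fintype_prod_eq_prod (fun i x => φ (f i) x * φ (g i) x)]
  simp_rw [horth]
  rw [Finset.prod_ite_zero]
  simp [funext_iff]

/-- Expanding each product chooses a word `f` of indices for the first sample; the pairing moves it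
to `f ∘ σ` on the second sample. Collecting the `σ` with the same image word produces `permCount`.
-/
theorem pairingAverage_eq_sum {E J : Type*} [Fintype J] [DecidableEq J] (t : J → ℝ)
    (φ ψ : J → E → ℝ) (N : ℕ) (z : (Fin N → E) × (Fin N → E)) :
    pairingAverage (fun w => ∑ j, t j * (φ j w.1 * ψ j w.2)) N z =
      ∑ a : (Fin N → J) × (Fin N → J),
        ((N.factorial : ℝ)⁻¹ * ((∏ i, t (a.1 i)) * permCount a.1 a.2)) *
          ((∏ i, φ (a.1 i) (z.1 i)) * ∏ i, ψ (a.2 i) (z.2 i)) := by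
  have h1 : ∀ σ : Equiv.Perm (Fin N), ∏ i, ∑ j, t j * (φ j (z.1 i) * ψ j (z.2 (σ⁻¹ i))) =
      ∑ f : Fin N → J, (∏ i, t (f i)) * ((∏ i, φ (f i) (z.1 i)) *
        ∏ i, ψ ((f ∘ σ) i) (z.2 i)) := fun σ => by
    rw [Finset.prod_univ_sum, Fintype.piFinset_univ]
    refine Finset.sum_congr rfl fun f _ => ?_
    rw [Finset.prod_mul_distrib, Finset.prod_mul_distrib]
    congr 2
    rw [← Equiv.prod_comp σ]
    simp
  -- Summing over `σ⁻¹` makes the word read on the second sample `f ∘ σ` instead of `f ∘ σ⁻¹`.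
  rw [pairingAverage, ← Equiv.sum_comp (Equiv.inv (Equiv.Perm (Fin N)))]
  simp only [Equiv.inv_apply]
  simp_rw [h1]
  rw [Finset.sum_comm, Fintype.sum_prod_type, Finset.mul_sum]
  refine Finset.sum_congr rfl fun f _ => ?_
  rw [← Finset.sum_fiberwise_of_maps_to (s := Finset.univ) (t := Finset.univ)
    (g := fun σ : Equiv.Perm (Fin N) => f ∘ σ) (fun _ _ => Finset.mem_univ _), Finset.mul_sum]
  refine Finset.sum_congr rfl fun g _ => ?_
  rw [Finset.sum_congr rfl fun σ hσ => by rw [(Finset.mem_filter.1 hσ).2], Finset.sum_const,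
    nsmul_eq_mul]
  simp only [permCount]
  ring

/-- The second moment of the average over pairings of a kernel of finite rank whose leading term
is the constant `1`. -/
theorem integral_pairingAverage_sq_le {K : Type*} [Fintype K] [DecidableEq K] {t : Option K → ℝ}
    {φ ψ : Option K → E → ℝ} (hφ : ∀ i, MemLp (φ i) 2 μ) (hψ : ∀ i, MemLp (ψ i) 2 ν)
    (hφo : ∀ i j, ∫ x, φ i x * φ j x ∂μ = if i = j then 1 else 0)
    (hψo : ∀ i j, ∫ x, ψ i x * ψ j x ∂ν = if i = j then 1 else 0)
    (hnone : t none = 1) (ht : ∀ k, t (some k) ^ 2 < 1) (N : ℕ) :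
    Integrable (fun z => pairingAverage (fun w => ∑ j, t j * (φ j w.1 * ψ j w.2)) N z ^ 2)
      (samplePair μ ν N) ∧
    ∫ z, pairingAverage (fun w => ∑ j, t j * (φ j w.1 * ψ j w.2)) N z ^ 2 ∂samplePair μ ν N ≤
      ∏ k, (1 - t (some k) ^ 2)⁻¹ := by
  simp_rw [pairingAverage_eq_sum t φ ψ N]
  have h := integral_sq_sum_of_orthonormal (P := samplePair μ ν N)
    (h := fun (a : (Fin N → Option K) × (Fin N → Option K)) (z : (Fin N → E) × (Fin N → E)) =>
      (∏ i, φ (a.1 i) (z.1 i)) * ∏ i, ψ (a.2 i) (z.2 i)) ?_ ?_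
    (fun a => (N.factorial : ℝ)⁻¹ * ((∏ i, t (a.1 i)) * permCount a.1 a.2))
  · refine ⟨h.1, h.2.trans_le ?_⟩
    rw [Fintype.sum_prod_type]
    -- Summing the squared coefficients over `g` with `sum_permCount_sq` cancels one of the two
    -- factors `1 / N!`.
    have : ∀ f : Fin N → Option K, ∑ g : Fin N → Option K,
        ((N.factorial : ℝ)⁻¹ * ((∏ i, t (f i)) * permCount f g)) ^ 2 =
        (N.factorial : ℝ)⁻¹ * ((∏ i, t (f i) ^ 2) * permCount f f) := fun f => by
      simp_rw [mul_pow]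
      rw [← Finset.mul_sum, ← Finset.mul_sum, ← Finset.prod_pow]
      have := sum_permCount_sq f
      have h2 : ∑ g, (permCount f g : ℝ) ^ 2 = N.factorial * permCount f f := by
        exact_mod_cast this
      rw [h2]
      field_simp
    simp only [this]
    rw [← Finset.mul_sum, inv_mul_le_iff₀ (by positivity)]
    exact sum_prod_mul_permCount_le (q := fun j => t j ^ 2) (by simp [hnone])
      (fun k => sq_nonneg _) ht
  · intro a b
    have := (integral_prod_comp_orthonormal hφ hφo a.1 b.1).1.mul_prod
      (integral_prod_comp_orthonormal hψ hψo a.2 b.2).1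
    refine this.congr (Eventually.of_forall fun z => ?_)
    simp only
    ring
  · intro a b
    have := integral_prod_mul (μ := Measure.pi fun _ : Fin N => μ)
      (ν := Measure.pi fun _ : Fin N => ν)
      (fun x => (∏ i, φ (a.1 i) (x i)) * ∏ i, φ (b.1 i) (x i))
      (fun x => (∏ i, ψ (a.2 i) (x i)) * ∏ i, ψ (b.2 i) (x i))
    rw [(integral_prod_comp_orthonormal hφ hφo a.1 b.1).2,
      (integral_prod_comp_orthonormal hψ hψo a.2 b.2).2] at this
    have h2 : (if a = b then (1 : ℝ) else 0) =
        (if a.1 = b.1 then 1 else 0) * (if a.2 = b.2 then 1 else 0) := by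
      by_cases h1 : a.1 = b.1 <;> by_cases h2 : a.2 = b.2 <;> simp [Prod.ext_iff, h1, h2]
    rw [h2, ← this]
    refine integral_congr_ae (Eventually.of_forall fun z => ?_)
    simp only
    ring

end SecondMoment

/-! ### The Mehler kernel: Gaussian density, second moment and entropy bound. -/

section Mehler

open ProbabilityTheory

/-- The density, with respect to the standard Gaussian measure of the plane, of the centred
Gaussian measure with unit variances and correlation `s`. -/
noncomputable def mehlerKernel (s : ℝ) (p : ℝ × ℝ) : ℝ :=
  (√(1 - s ^ 2))⁻¹ *
    Real.exp (-(s ^ 2 * p.1 ^ 2 - 2 * s * p.1 * p.2 + s ^ 2 * p.2 ^ 2) / (2 * (1 - s ^ 2)))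

/-- The standard Gaussian measure of the plane. -/
noncomputable abbrev gaussianPlane : Measure (ℝ × ℝ) := (gaussianReal 0 1).prod (gaussianReal 0 1)

/-- The centred Gaussian measure of the plane with unit variances and correlation `s`. -/
noncomputable def correlatedGaussian (s : ℝ) : Measure (ℝ × ℝ) :=
  gaussianPlane.map fun p => (p.1, s * p.1 + √(1 - s ^ 2) * p.2)

instance (s : ℝ) : IsProbabilityMeasure (correlatedGaussian s) :=
  Measure.isProbabilityMeasure_map (by fun_prop)

theorem correlatedGaussian_zero : correlatedGaussian 0 = gaussianPlane := by
  simp [correlatedGaussian]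

theorem continuous_mehlerKernel (s : ℝ) : Continuous (mehlerKernel s) := by
  unfold mehlerKernel
  fun_prop

theorem mehlerKernel_pos {s : ℝ} (hs : s ^ 2 < 1) (p : ℝ × ℝ) : 0 < mehlerKernel s p :=
  mul_pos (inv_pos.2 (Real.sqrt_pos.2 (by linarith))) (Real.exp_pos _)

/-- Completing the square in `v` gives the conditional density of the second coordinate given `u`,
which is normal with mean `s * u` and variance `1 - s ^ 2`. -/
theorem mehlerKernel_mul_gaussianPDFReal {s : ℝ} (hs : s ^ 2 < 1) (u v : ℝ) :
    mehlerKernel s (u, v) * gaussianPDFReal 0 1 v =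
      gaussianPDFReal (s * u) (1 - s ^ 2).toNNReal v := by
  have h : 0 < 1 - s ^ 2 := by linarith
  simp only [mehlerKernel, gaussianPDFReal, NNReal.coe_one, Real.coe_toNNReal _ h.le]
  rw [Real.sqrt_mul (by positivity) (1 - s ^ 2), mul_one, mul_inv, mul_mul_mul_comm, ← Real.exp_add,
    mul_comm (√(1 - s ^ 2))⁻¹]
  congr 2
  field_simp
  ring

theorem gaussianReal_map_affine {s : ℝ} (hs : s ^ 2 < 1) (u : ℝ) :
    (gaussianReal 0 1).map (fun z => s * u + √(1 - s ^ 2) * z) =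
      gaussianReal (s * u) (1 - s ^ 2).toNNReal := by
  have : (fun z => s * u + √(1 - s ^ 2) * z) = (s * u + ·) ∘ (√(1 - s ^ 2) * ·) := rfl
  rw [this, ← Measure.map_map (by fun_prop) (by fun_prop), gaussianReal_map_const_mul,
    gaussianReal_map_const_add]
  congr 1
  · ring
  · have h : 0 ≤ 1 - s ^ 2 := by linarith
    ext
    rw [Real.coe_toNNReal _ h, NNReal.coe_mul, NNReal.coe_one, mul_one]
    exact Real.sq_sqrt h

theorem lintegral_gaussianReal {μ : ℝ} {v : NNReal} (hv : v ≠ 0) {f : ℝ → ℝ≥0∞}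
    (hf : Measurable f) :
    ∫⁻ x, f x ∂gaussianReal μ v = ∫⁻ x, ENNReal.ofReal (gaussianPDFReal μ v x) * f x := by
  rw [gaussianReal_of_var_ne_zero _ hv,
    lintegral_withDensity_eq_lintegral_mul _ (measurable_gaussianPDF μ v) hf]
  rfl

theorem correlatedGaussian_eq_withDensity {s : ℝ} (hs : s ^ 2 < 1) :
    correlatedGaussian s =
      gaussianPlane.withDensity fun p => ENNReal.ofReal (mehlerKernel s p) := by
  have hm : Measurable (mehlerKernel s) := (continuous_mehlerKernel s).measurable
  have hv : (1 - s ^ 2).toNNReal ≠ 0 := (Real.toNNReal_pos.2 (by linarith)).ne'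
  refine Measure.ext_of_lintegral _ fun f hf => ?_
  rw [correlatedGaussian, lintegral_map hf (by fun_prop),
    lintegral_withDensity_eq_lintegral_mul _ (by fun_prop) hf,
    lintegral_prod _ (by fun_prop), lintegral_prod _ (by fun_prop)]
  refine lintegral_congr fun u => ?_
  have h1 := lintegral_map (μ := gaussianReal 0 1) (f := fun v => f (u, v))
    (g := fun z => s * u + √(1 - s ^ 2) * z) (by fun_prop) (by fun_prop)
  rw [gaussianReal_map_affine hs, lintegral_gaussianReal hv (by fun_prop)] at h1
  rw [← h1, lintegral_gaussianReal one_ne_zero (by fun_prop)]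
  refine lintegral_congr fun v => ?_
  rw [← mehlerKernel_mul_gaussianPDFReal hs, ENNReal.ofReal_mul (mehlerKernel_pos hs _).le]
  simp only [Pi.mul_apply]
  ring

theorem charFun_correlatedGaussian {s : ℝ} (hs : s ^ 2 < 1) (a b : ℝ) :
    ∫ p, Complex.exp ((a * p.1 + b * p.2 : ℝ) * Complex.I) ∂correlatedGaussian s =
      Complex.exp (-((a ^ 2 + 2 * s * a * b + b ^ 2 : ℝ) : ℂ) / 2) := by
  rw [correlatedGaussian, integral_map (by fun_prop) (by fun_prop)]
  have h : ∀ p : ℝ × ℝ, Complex.exp (((a * p.1 + b * (s * p.1 + √(1 - s ^ 2) * p.2) : ℝ) : ℂ) *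
      Complex.I) = Complex.exp ((a + b * s : ℝ) * p.1 * Complex.I) *
        Complex.exp ((b * √(1 - s ^ 2) : ℝ) * p.2 * Complex.I) := fun p => by
    rw [← Complex.exp_add]
    congr 1
    push_cast
    ring
  simp only [h]
  rw [integral_prod_mul (fun u : ℝ => Complex.exp ((a + b * s : ℝ) * u * Complex.I))
    (fun u : ℝ => Complex.exp ((b * √(1 - s ^ 2) : ℝ) * u * Complex.I)),
    ← charFun_apply_real, ← charFun_apply_real, charFun_gaussianReal, charFun_gaussianReal,
    ← Complex.exp_add]
  congr 1
  have h2 : ((√(1 - s ^ 2) : ℝ) : ℂ) ^ 2 = 1 - (s : ℂ) ^ 2 := by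
    rw [← Complex.ofReal_pow, Real.sq_sqrt (by linarith)]
    push_cast
    ring
  push_cast
  rw [mul_pow, h2]
  ring

/-- Two successive completions of the square: the integrand is a constant times a normal density in
`v`, and what remains is a constant times a normal density in `u`. -/
theorem lintegral_mehlerKernel_sq {s : ℝ} (hs : s ^ 2 < 1) :
    ∫⁻ p, ENNReal.ofReal (mehlerKernel s p ^ 2) ∂gaussianPlane =
      ENNReal.ofReal (1 - s ^ 2)⁻¹ := by
  have h : 0 < 1 - s ^ 2 := by linarith
  have h' : 0 < 1 + s ^ 2 := by positivity
  have hm : Measurable (mehlerKernel s) := (continuous_mehlerKernel s).measurable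
  -- `w` is the variance appearing in `v` and `w' = w⁻¹` the one appearing in `u`; their
  -- normalizations cancel, which leaves `(1 - s ^ 2)⁻¹`.
  set w : NNReal := ⟨(1 - s ^ 2) / (1 + s ^ 2), by positivity⟩ with hw
  set w' : NNReal := ⟨(1 + s ^ 2) / (1 - s ^ 2), by positivity⟩ with hw'
  have hwc : (w : ℝ) = (1 - s ^ 2) / (1 + s ^ 2) := rfl
  have hwc' : (w' : ℝ) = (1 + s ^ 2) / (1 - s ^ 2) := rfl
  have hw0 : w ≠ 0 := NNReal.coe_ne_zero.1 (by rw [hwc]; positivity)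
  have hw0' : w' ≠ 0 := NNReal.coe_ne_zero.1 (by rw [hwc']; positivity)
  have e1 : ∀ u v, gaussianPDFReal 0 1 v * mehlerKernel s (u, v) ^ 2 =
      (1 - s ^ 2)⁻¹ * √(w : ℝ) * Real.exp (s ^ 2 * u ^ 2 / (1 + s ^ 2)) *
        gaussianPDFReal (2 * s * u / (1 + s ^ 2)) w v := fun u v => by
    have hsw : √(w : ℝ) ≠ 0 := Real.sqrt_ne_zero'.2 (by rw [hwc]; positivity)
    simp only [mehlerKernel, gaussianPDFReal, NNReal.coe_one]
    rw [Real.sqrt_mul (by positivity) (w : ℝ), mul_one, mul_pow, inv_pow, Real.sq_sqrt h.le,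
      ← Real.exp_nat_mul]
    have : ∀ A B C D x : ℝ, Real.exp A * Real.exp B = Real.exp C * Real.exp D →
        x * Real.exp A * ((1 - s ^ 2)⁻¹ * Real.exp B) =
          (1 - s ^ 2)⁻¹ * √(w : ℝ) * Real.exp C * (x * (√(w : ℝ))⁻¹ * Real.exp D) := by
      intro A B C D x hE
      calc _ = x * (1 - s ^ 2)⁻¹ * (Real.exp A * Real.exp B) := by ring
        _ = x * (1 - s ^ 2)⁻¹ * (Real.exp C * Real.exp D) * (√(w : ℝ) * (√(w : ℝ))⁻¹) := by
          rw [hE, mul_inv_cancel₀ hsw, mul_one]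
        _ = _ := by ring
    rw [mul_inv]
    apply this
    rw [← Real.exp_add, ← Real.exp_add, hwc]
    congr 1
    field_simp
    ring
  have e2 : ∀ u, gaussianPDFReal 0 1 u * ((1 - s ^ 2)⁻¹ * √(w : ℝ) *
      Real.exp (s ^ 2 * u ^ 2 / (1 + s ^ 2))) = (1 - s ^ 2)⁻¹ * gaussianPDFReal 0 w' u :=
    fun u => by
    have hww : √(w : ℝ) = (√(w' : ℝ))⁻¹ := by
      rw [← Real.sqrt_inv, hwc, hwc', inv_div]
    simp only [gaussianPDFReal, NNReal.coe_one]
    rw [Real.sqrt_mul (by positivity) (w' : ℝ), mul_one, mul_inv, hww]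
    have hE : Real.exp (-(u - 0) ^ 2 / 2) * Real.exp (s ^ 2 * u ^ 2 / (1 + s ^ 2)) =
        Real.exp (-(u - 0) ^ 2 / (2 * (w' : ℝ))) := by
      rw [← Real.exp_add, hwc']
      congr 1
      field_simp
      ring
    rw [← hE]
    ring_nf
  rw [lintegral_prod _ (by fun_prop), lintegral_gaussianReal one_ne_zero (by fun_prop)]
  have h1 : ∀ u, ∫⁻ v, ENNReal.ofReal (mehlerKernel s (u, v) ^ 2) ∂gaussianReal 0 1 =
      ENNReal.ofReal ((1 - s ^ 2)⁻¹ * √(w : ℝ) * Real.exp (s ^ 2 * u ^ 2 / (1 + s ^ 2))) :=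
    fun u => by
    rw [lintegral_gaussianReal one_ne_zero (by fun_prop)]
    simp_rw [← ENNReal.ofReal_mul (gaussianPDFReal_nonneg 0 1 _), e1]
    simp_rw [ENNReal.ofReal_mul (by positivity : 0 ≤ (1 - s ^ 2)⁻¹ * √(w : ℝ) *
      Real.exp (s ^ 2 * u ^ 2 / (1 + s ^ 2)))]
    rw [lintegral_const_mul _ (by fun_prop), lintegral_gaussianPDFReal_eq_one _ hw0, mul_one]
  simp_rw [h1, ← ENNReal.ofReal_mul (gaussianPDFReal_nonneg 0 1 _), e2,
    ENNReal.ofReal_mul (inv_nonneg.2 h.le)]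
  rw [lintegral_const_mul _ (by fun_prop), lintegral_gaussianPDFReal_eq_one _ hw0', mul_one]

theorem integrable_sq_gaussianReal : Integrable (fun x : ℝ => x ^ 2) (gaussianReal 0 1) :=
  (memLp_id_gaussianReal 2).integrable_sq

theorem integral_sq_gaussianReal : ∫ x : ℝ, x ^ 2 ∂gaussianReal 0 1 = 1 := by
  have h := variance_fun_id_gaussianReal (μ := 0) (v := 1)
  rw [variance_eq_integral measurable_id'.aemeasurable, integral_id_gaussianReal] at h
  simpa using h

/-- The logarithm is a quadratic polynomial, so only Gaussian moments of order at most two enter;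
the normalization term `log √(1 - s ^ 2)` is nonpositive and is dropped. A bound of order `s ^ 2` is
what makes the sum over all singular values finite. -/
theorem integral_neg_log_mehlerKernel_le {s : ℝ} (hs : s ^ 2 < 1) :
    Integrable (fun p => -Real.log (mehlerKernel s p)) gaussianPlane ∧
    ∫ p, -Real.log (mehlerKernel s p) ∂gaussianPlane ≤ s ^ 2 / (1 - s ^ 2) := by
  have h : 0 < 1 - s ^ 2 := by linarith
  have e : ∀ p : ℝ × ℝ, -Real.log (mehlerKernel s p) = Real.log (√(1 - s ^ 2)) +
      (2 * (1 - s ^ 2))⁻¹ * (s ^ 2 * p.1 ^ 2 - 2 * s * (p.1 * p.2) + s ^ 2 * p.2 ^ 2) := fun p => by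
    rw [mehlerKernel, Real.log_mul (inv_ne_zero (Real.sqrt_ne_zero'.2 h)) (Real.exp_ne_zero _),
      Real.log_exp, Real.log_inv]
    ring
  have hid : Integrable (fun x : ℝ => x) (gaussianReal 0 1) :=
    (memLp_id_gaussianReal 1).integrable le_rfl
  have i1 : Integrable (fun p : ℝ × ℝ => s ^ 2 * p.1 ^ 2) gaussianPlane :=
    (integrable_sq_gaussianReal.comp_fst _).const_mul _
  have i2 : Integrable (fun p : ℝ × ℝ => s ^ 2 * p.2 ^ 2) gaussianPlane :=
    (integrable_sq_gaussianReal.comp_snd _).const_mul _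
  have i3 : Integrable (fun p : ℝ × ℝ => 2 * s * (p.1 * p.2)) gaussianPlane :=
    (hid.mul_prod hid).const_mul _
  have i4 : Integrable (fun p : ℝ × ℝ => s ^ 2 * p.1 ^ 2 - 2 * s * (p.1 * p.2)) gaussianPlane :=
    i1.sub i3
  have i5 : Integrable (fun p : ℝ × ℝ => (2 * (1 - s ^ 2))⁻¹ *
      (s ^ 2 * p.1 ^ 2 - 2 * s * (p.1 * p.2) + s ^ 2 * p.2 ^ 2)) gaussianPlane :=
    (i4.add i2).const_mul _
  simp_rw [e]
  refine ⟨(integrable_const _).add i5, ?_⟩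
  rw [integral_add (integrable_const _) i5, integral_const_mul,
    integral_add i4 i2, integral_sub i1 i3, integral_const_mul, integral_const_mul,
    integral_const_mul, integral_prod_mul (fun x : ℝ => x) (fun x : ℝ => x),
    integral_fun_fst (fun x : ℝ => x ^ 2), integral_fun_snd (fun x : ℝ => x ^ 2),
    integral_sq_gaussianReal, integral_id_gaussianReal]
  have hlog : Real.log (√(1 - s ^ 2)) ≤ 0 :=
    Real.log_nonpos (Real.sqrt_nonneg _) (Real.sqrt_le_one.2 (by nlinarith))
  have e3 : (2 * (1 - s ^ 2))⁻¹ * (s ^ 2 * 1 - 2 * s * (0 * 0) + s ^ 2 * 1) =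
      s ^ 2 / (1 - s ^ 2) := by
    field_simp
    ring
  simp only [probReal_univ, smul_eq_mul, integral_const, one_mul]
  linarith

end Mehler

/-! ### Finite products of Mehler kernels, uniformly in the number of factors. -/

section MehlerProduct

open ProbabilityTheory

variable {K : Type*} [Fintype K] {s : K → ℝ}

/-- The law of a finite family of independent pairs of standard Gaussian variables. -/
noncomputable abbrev gaussianPairs (K : Type*) [Fintype K] : Measure (K → ℝ × ℝ) :=
  Measure.pi fun _ => gaussianPlane

/-- The product of the Mehler kernels with parameters `s k`. -/
noncomputable def mehlerProd (s : K → ℝ) (x : K → ℝ × ℝ) : ℝ := ∏ k, mehlerKernel (s k) (x k)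

theorem continuous_mehlerProd (s : K → ℝ) : Continuous (mehlerProd s) :=
  continuous_finsetProd _ fun k _ => (continuous_mehlerKernel (s k)).comp (continuous_apply k)

theorem mehlerProd_pos (hs : ∀ k, s k ^ 2 < 1) (x : K → ℝ × ℝ) : 0 < mehlerProd s x :=
  Finset.prod_pos fun k _ => mehlerKernel_pos (hs k) _

theorem pi_correlatedGaussian (hs : ∀ k, s k ^ 2 < 1) :
    Measure.pi (fun k => correlatedGaussian (s k)) =
      (gaussianPairs K).withDensity fun x => ENNReal.ofReal (mehlerProd s x) := by
  have hf : ∀ k, Measurable fun p => ENNReal.ofReal (mehlerKernel (s k) p) := fun k =>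
    (continuous_mehlerKernel (s k)).measurable.ennreal_ofReal
  have : ∀ k, SigmaFinite (gaussianPlane.withDensity
      fun p => ENNReal.ofReal (mehlerKernel (s k) p)) := fun k => by
    rw [← correlatedGaussian_eq_withDensity (hs k)]
    infer_instance
  have h := pi_withDensity (fun _ : K => gaussianPlane) hf
  simp_rw [← correlatedGaussian_eq_withDensity (hs _)] at h
  rw [h]
  congr 1
  ext x
  rw [mehlerProd, ENNReal.ofReal_prod_of_nonneg fun k _ => (mehlerKernel_pos (hs k) _).le]

theorem integral_pi_correlatedGaussian (hs : ∀ k, s k ^ 2 < 1) (h : (K → ℝ × ℝ) → ℝ) :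
    ∫ x, h x ∂Measure.pi (fun k => correlatedGaussian (s k)) =
      ∫ x, mehlerProd s x * h x ∂gaussianPairs K := by
  rw [pi_correlatedGaussian hs, integral_withDensity_eq_integral_toReal_smul
    (continuous_mehlerProd s).measurable.ennreal_ofReal
    (Eventually.of_forall fun _ => ENNReal.ofReal_lt_top)]
  simp_rw [ENNReal.toReal_ofReal (mehlerProd_pos hs _).le, smul_eq_mul]

theorem integrable_mehlerKernel_sq {s : ℝ} (hs : s ^ 2 < 1) :
    Integrable (fun p => mehlerKernel s p ^ 2) gaussianPlane := by
  refine ⟨((continuous_mehlerKernel s).pow 2).aestronglyMeasurable, ?_⟩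
  rw [hasFiniteIntegral_iff_ofReal (Eventually.of_forall fun _ => sq_nonneg _),
    lintegral_mehlerKernel_sq hs]
  exact ENNReal.ofReal_lt_top

theorem integral_mehlerKernel_sq {s : ℝ} (hs : s ^ 2 < 1) :
    ∫ p, mehlerKernel s p ^ 2 ∂gaussianPlane = (1 - s ^ 2)⁻¹ := by
  rw [integral_eq_lintegral_of_nonneg_ae (Eventually.of_forall fun _ => sq_nonneg _)
    ((continuous_mehlerKernel s).pow 2).aestronglyMeasurable, lintegral_mehlerKernel_sq hs,
    ENNReal.toReal_ofReal (inv_nonneg.2 (by linarith))]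

theorem integrable_mehlerProd_sq (hs : ∀ k, s k ^ 2 < 1) :
    Integrable (fun x => mehlerProd s x ^ 2) (gaussianPairs K) := by
  simp_rw [mehlerProd, ← Finset.prod_pow]
  exact Integrable.fintype_prod (f := fun k p => mehlerKernel (s k) p ^ 2)
    fun k => integrable_mehlerKernel_sq (hs k)

theorem integral_mehlerProd_sq (hs : ∀ k, s k ^ 2 < 1) :
    ∫ x, mehlerProd s x ^ 2 ∂gaussianPairs K = ∏ k, (1 - s k ^ 2)⁻¹ := by
  simp_rw [mehlerProd, ← Finset.prod_pow]
  rw [integral_fintype_prod_eq_prod (fun k p => mehlerKernel (s k) p ^ 2)]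
  simp_rw [integral_mehlerKernel_sq (hs _)]

theorem memLp_mehlerProd (hs : ∀ k, s k ^ 2 < 1) : MemLp (mehlerProd s) 2 (gaussianPairs K) :=
  (memLp_two_iff_integrable_sq (continuous_mehlerProd s).aestronglyMeasurable).2
    (integrable_mehlerProd_sq hs)

theorem integral_mehlerProd (hs : ∀ k, s k ^ 2 < 1) :
    ∫ x, mehlerProd s x ∂gaussianPairs K = 1 := by
  have h := integral_pi_correlatedGaussian hs fun _ => 1
  simpa using h.symm

/-- The product of Mehler kernels is small with small probability only, uniformly in the
number of factors. -/
theorem measureReal_mehlerProd_le (hs : ∀ k, s k ^ 2 < 1) {η : ℝ} (h0 : 0 < η) (h1 : η < 1) :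
    (gaussianPairs K).real {x | mehlerProd s x ≤ η} ≤
      (∑ k, s k ^ 2 / (1 - s k ^ 2) + 1) / Real.log η⁻¹ := by
  have hlog : 0 < Real.log η⁻¹ := Real.log_pos ((one_lt_inv₀ h0).2 h1)
  have hF : Integrable (mehlerProd s) (gaussianPairs K) :=
    (memLp_mehlerProd hs).integrable one_le_two
  have hL : ∀ x, -Real.log (mehlerProd s x) = ∑ k, -Real.log (mehlerKernel (s k) (x k)) :=
    fun x => by
    rw [mehlerProd, Real.log_prod fun k _ => (mehlerKernel_pos (hs k) _).ne',
      Finset.sum_neg_distrib]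
  have hLi : ∀ k, Integrable (fun x : K → ℝ × ℝ => -Real.log (mehlerKernel (s k) (x k)))
      (gaussianPairs K) := fun k =>
    integrable_comp_eval (μ := fun _ : K => gaussianPlane) (i := k)
      (f := fun p => -Real.log (mehlerKernel (s k) p)) (integral_neg_log_mehlerKernel_le (hs k)).1
  have hLi' : Integrable (fun x => -Real.log (mehlerProd s x)) (gaussianPairs K) := by
    simp_rw [hL]
    exact integrable_finsetSum _ fun k _ => hLi k
  -- `-log F` has no sign, but `F - log F` is positive, so Markov's inequality applies to it; since
  -- `∫ F = 1`, the correction accounts for the `+ 1` in the bound.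
  have hW : ∀ x, 0 ≤ -Real.log (mehlerProd s x) + mehlerProd s x := fun x => by
    have := Real.log_le_sub_one_of_pos (mehlerProd_pos hs x)
    linarith
  have hmarkov := mul_meas_ge_le_integral_of_nonneg (Eventually.of_forall hW) (hLi'.add hF)
    (Real.log η⁻¹)
  rw [le_div_iff₀' hlog]
  calc Real.log η⁻¹ * (gaussianPairs K).real {x | mehlerProd s x ≤ η}
      ≤ Real.log η⁻¹ * (gaussianPairs K).real
          {x | Real.log η⁻¹ ≤ -Real.log (mehlerProd s x) + mehlerProd s x} := by
        refine mul_le_mul_of_nonneg_left (measureReal_mono fun x hx => ?_) hlog.le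
        have hx1 : Real.log (mehlerProd s x) ≤ Real.log η :=
          Real.log_le_log (mehlerProd_pos hs x) hx
        have hx2 := mehlerProd_pos hs x
        rw [Set.mem_ofPred_eq, Real.log_inv]
        linarith
    _ ≤ ∫ x, (-Real.log (mehlerProd s x) + mehlerProd s x) ∂gaussianPairs K := hmarkov
    _ ≤ _ := by
        rw [integral_add hLi' hF, integral_mehlerProd hs]
        simp_rw [hL]
        rw [integral_finsetSum _ fun k _ => hLi k]
        refine add_le_add (Finset.sum_le_sum fun k _ => ?_) le_rfl
        rw [integral_comp_eval (μ := fun _ : K => gaussianPlane) (i := k)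
          (f := fun p => -Real.log (mehlerKernel (s k) p))
          (integral_neg_log_mehlerKernel_le (hs k)).1.aestronglyMeasurable]
        exact (integral_neg_log_mehlerKernel_le (hs k)).2

/-- The truncations of the product of Mehler kernels converge in mean square. -/
theorem exists_truncation_mehlerProd (hs : ∀ k, s k ^ 2 < 1) {δ : ℝ} (hδ : 0 < δ) :
    ∃ M : ℝ, 1 ≤ M ∧ ∏ k, (1 - s k ^ 2)⁻¹ - δ ≤
      ∫ x, min (mehlerProd s x) M ^ 2 ∂gaussianPairs K := by
  have hc := continuous_mehlerProd s
  have h : Tendsto (fun n : ℕ => ∫ x, min (mehlerProd s x) n ^ 2 ∂gaussianPairs K) atTop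
      (𝓝 (∫ x, mehlerProd s x ^ 2 ∂gaussianPairs K)) := by
    refine tendsto_integral_of_dominated_convergence (fun x => mehlerProd s x ^ 2)
      (fun n => Continuous.aestronglyMeasurable (by fun_prop)) (integrable_mehlerProd_sq hs)
      (fun n => Eventually.of_forall fun x => ?_) (Eventually.of_forall fun x => ?_)
    · rw [Real.norm_eq_abs, abs_of_nonneg (sq_nonneg _)]
      exact pow_le_pow_left₀ (le_min (mehlerProd_pos hs x).le (Nat.cast_nonneg n))
        (min_le_left _ _) 2
    · refine tendsto_const_nhds.congr' ?_
      obtain ⟨n, hn⟩ := exists_nat_ge (mehlerProd s x)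
      filter_upwards [eventually_ge_atTop n] with m hm
      rw [min_eq_left (hn.trans (Nat.cast_le.2 hm))]
  rw [integral_mehlerProd_sq hs] at h
  obtain ⟨n, hn, hn1⟩ := ((h.eventually (lt_mem_nhds (sub_lt_self _ hδ))).and
    (eventually_ge_atTop 1)).exists
  exact ⟨n, Nat.one_le_cast.2 hn1, hn.le⟩

end MehlerProduct

/-! ### Central limit theorem for the normalized sums of the two samples. -/

section CentralLimit

open ProbabilityTheory

variable {E : Type*} [MeasurableSpace E]

instance (π : Measure (E × E)) [IsProbabilityMeasure π] : IsProbabilityMeasure (iidLaw π) := by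
  unfold iidLaw
  infer_instance

/-- The frequency 1 suffices, because the multivariate frequency is absorbed into `Z`. -/
theorem tendsto_integral_exp_normalizedSum (π : Measure (E × E)) [IsProbabilityMeasure π]
    {Z : E × E → ℝ} (hZ : Measurable Z) (hZ2 : MemLp Z 2 π) (h0 : ∫ p, Z p ∂π = 0) :
    Tendsto (fun N : ℕ => ∫ ω, Complex.exp
      (((√N)⁻¹ * ∑ k ∈ Finset.range N, Z (ω k) : ℝ) * Complex.I) ∂iidLaw π) atTop
      (𝓝 (Complex.exp (-((∫ p, Z p ^ 2 ∂π : ℝ) : ℂ) / 2))) := by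
  have hmp : ∀ i, MeasurePreserving (fun ω : ℕ → E × E => ω i) (iidLaw π) π := fun i =>
    measurePreserving_eval_infinitePi (fun _ : ℕ => π) i
  have hZi : ∀ i, Measurable fun ω : ℕ → E × E => Z (ω i) := fun i => hZ.comp (hmp i).measurable
  have hint : ∀ g : E × E → ℝ, Measurable g → ∫ ω, g (ω 0) ∂iidLaw π = ∫ p, g p ∂π := fun g hg => by
    have := integral_map (μ := iidLaw π) (φ := fun ω : ℕ → E × E => ω 0) (f := g)
      (hmp 0).measurable.aemeasurable hg.aestronglyMeasurable
    rw [(hmp 0).map_eq] at this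
    exact this.symm
  have hident : ∀ i, IdentDistrib (fun ω : ℕ → E × E => Z (ω i)) (fun ω => Z (ω 0))
      (iidLaw π) (iidLaw π) := fun i =>
    { aemeasurable_fst := (hZi i).aemeasurable
      aemeasurable_snd := (hZi 0).aemeasurable
      map_eq := by
        change Measure.map (Z ∘ fun ω : ℕ → E × E => ω i) _ =
          Measure.map (Z ∘ fun ω : ℕ → E × E => ω 0) _
        rw [← Measure.map_map hZ (hmp i).measurable, ← Measure.map_map hZ (hmp 0).measurable,
          (hmp i).map_eq, (hmp 0).map_eq] }
  have hindep : iIndepFun (fun (i : ℕ) (ω : ℕ → E × E) => Z (ω i)) (iidLaw π) :=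
    iIndepFun_infinitePi (P := fun _ : ℕ => π) (X := fun _ => Z) fun _ => hZ
  have hmean : ∫ ω, Z (ω 0) ∂iidLaw π = 0 := (hint Z hZ).trans h0
  have hvar : Var[fun ω : ℕ → E × E => Z (ω 0); iidLaw π] = ∫ p, Z p ^ 2 ∂π := by
    rw [variance_of_integral_eq_zero (hZi 0).aemeasurable hmean]
    exact hint (fun p => Z p ^ 2) (hZ.pow_const 2)
  have h := tendstoInDistribution_inv_sqrt_mul_sum_sub (P := iidLaw π)
    (X := fun (i : ℕ) (ω : ℕ → E × E) => Z (ω i)) (Y := id) ⟨by fun_prop, Measure.map_id⟩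
    (hZ2.comp_measurePreserving (hmp 0)) hindep hident
  have h1 := ProbabilityMeasure.tendsto_iff_tendsto_charFun.1 h.tendsto 1
  simp only [ProbabilityMeasure.coe_mk, Measure.map_id] at h1
  rw [charFun_gaussianReal, hvar, Real.coe_toNNReal _ (integral_nonneg fun _ => sq_nonneg _)] at h1
  convert h1 using 2
  · rename_i N
    rw [charFun_apply_real, integral_map (Measurable.aemeasurable (by fun_prop)) (by fun_prop)]
    simp [hmean]
  · congr 1
    simp
    ring

variable {K : Type*}

/-- The normalized sums `N^{-1/2} ∑ φ_k(x_i)` and `N^{-1/2} ∑ ψ_k(y_i)` over two samples. -/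
noncomputable def normalizedSums (φ ψ : K → E → ℝ) (N : ℕ) (z : (Fin N → E) × (Fin N → E)) :
    K → ℝ × ℝ :=
  fun k => ((√N)⁻¹ * ∑ i, φ k (z.1 i), (√N)⁻¹ * ∑ i, ψ k (z.2 i))

theorem measurable_normalizedSums {φ ψ : K → E → ℝ} (hφ : ∀ k, Measurable (φ k))
    (hψ : ∀ k, Measurable (ψ k)) (N : ℕ) : Measurable (normalizedSums φ ψ N) := by
  unfold normalizedSums
  fun_prop

theorem normalizedSums_perm {E : Type*} (φ ψ : K → E → ℝ) (N : ℕ) (x y : Fin N → E)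
    (σ : Equiv.Perm (Fin N)) :
    normalizedSums φ ψ N (x, y ∘ σ) = normalizedSums φ ψ N (x, y) := by
  funext k
  simp only [normalizedSums, Function.comp_apply]
  rw [Equiv.sum_comp σ fun i => ψ k (y i)]

/-- Reading a family of pairs of real numbers as a vector of a Euclidean space. -/
def pairsToEuclidean (x : K → ℝ × ℝ) : EuclideanSpace ℝ (K ⊕ K) :=
  WithLp.toLp 2 (Sum.elim (fun k => (x k).1) fun k => (x k).2)

theorem continuous_pairsToEuclidean : Continuous (pairsToEuclidean (K := K)) := by
  refine (PiLp.continuous_toLp 2 _).comp (continuous_pi fun j => ?_)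
  cases j <;> simp only [Sum.elim_inl, Sum.elim_inr] <;> fun_prop

variable [Fintype K]

theorem inner_pairsToEuclidean (x : K → ℝ × ℝ) (t : EuclideanSpace ℝ (K ⊕ K)) :
    inner ℝ (pairsToEuclidean x) t = ∑ k, (t (.inl k) * (x k).1 + t (.inr k) * (x k).2) := by
  simp [pairsToEuclidean, PiLp.inner_apply, Fintype.sum_sum_type, Finset.sum_add_distrib]

/-- The central limit theorem for the normalized sums, when the functions are orthonormal for the
marginals and are paired diagonally by the coupling. -/
theorem tendsto_integral_normalizedSums [DecidableEq K] (π : Measure (E × E))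
    [IsProbabilityMeasure π] {φ ψ : K → E → ℝ} {s : K → ℝ} (hs : ∀ k, s k ^ 2 < 1)
    (hφ : ∀ k, Measurable (φ k)) (hψ : ∀ k, Measurable (ψ k))
    (hφ2 : ∀ k, MemLp (fun p : E × E => φ k p.1) 2 π)
    (hψ2 : ∀ k, MemLp (fun p : E × E => ψ k p.2) 2 π)
    (hφ0 : ∀ k, ∫ p, φ k p.1 ∂π = 0) (hψ0 : ∀ k, ∫ p, ψ k p.2 ∂π = 0)
    (hφφ : ∀ k l, ∫ p, φ k p.1 * φ l p.1 ∂π = if k = l then 1 else 0)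
    (hψψ : ∀ k l, ∫ p, ψ k p.2 * ψ l p.2 ∂π = if k = l then 1 else 0)
    (hφψ : ∀ k l, ∫ p, φ k p.1 * ψ l p.2 ∂π = if k = l then s k else 0)
    {h : (K → ℝ × ℝ) → ℝ} (hcont : Continuous h) {C : ℝ} (hbound : ∀ x, |h x| ≤ C) :
    Tendsto (fun N => ∫ z, h (normalizedSums φ ψ N z) ∂(iidLaw π).map (splitSample N)) atTop
      (𝓝 (∫ x, h x ∂Measure.pi fun k => correlatedGaussian (s k))) := by
  have hS : ∀ N, Measurable fun ω : ℕ → E × E => normalizedSums φ ψ N (splitSample N ω) := fun N =>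
    (measurable_normalizedSums hφ hψ N).comp (measurable_splitSample N)
  have hT : Measurable (pairsToEuclidean (K := K)) := continuous_pairsToEuclidean.measurable
  have hTS : ∀ N, Measurable fun ω : ℕ → E × E =>
      pairsToEuclidean (normalizedSums φ ψ N (splitSample N ω)) := fun N => hT.comp (hS N)
  let law : ℕ → ProbabilityMeasure (EuclideanSpace ℝ (K ⊕ K)) := fun N =>
    ⟨(iidLaw π).map fun ω => pairsToEuclidean (normalizedSums φ ψ N (splitSample N ω)),
      Measure.isProbabilityMeasure_map (hTS N).aemeasurable⟩
  let lim : ProbabilityMeasure (EuclideanSpace ℝ (K ⊕ K)) :=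
    ⟨(Measure.pi fun k => correlatedGaussian (s k)).map pairsToEuclidean,
      Measure.isProbabilityMeasure_map hT.aemeasurable⟩
  have key : Tendsto law atTop (𝓝 lim) := by
    refine ProbabilityMeasure.tendsto_iff_tendsto_charFun.2 fun t => ?_
    -- Cramér–Wold: the characteristic function at `t` of the vector of sums is that at 1 of the
    -- normalized sum of the scalar `Z`, whose variance is the quadratic form of the limiting
    -- covariance.
    let Z : E × E → ℝ := fun p => ∑ k, (t (.inl k) * φ k p.1 + t (.inr k) * ψ k p.2)
    have hZm : Measurable Z := by fun_prop
    have hZ2 : MemLp Z 2 π := memLp_finsetSum _ fun k _ =>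
      ((hφ2 k).const_mul _).add ((hψ2 k).const_mul _)
    have i1 : ∀ k, Integrable (fun p : E × E => t (.inl k) * φ k p.1) π := fun k =>
      ((hφ2 k).integrable one_le_two).const_mul _
    have i2 : ∀ k, Integrable (fun p : E × E => t (.inr k) * ψ k p.2) π := fun k =>
      ((hψ2 k).integrable one_le_two).const_mul _
    have i3 : ∀ k, Integrable (fun p : E × E => t (.inl k) * φ k p.1 + t (.inr k) * ψ k p.2) π :=
      fun k => (i1 k).add (i2 k)
    have hZ0 : ∫ p, Z p ∂π = 0 := by
      rw [integral_finsetSum _ fun k _ => i3 k]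
      refine Finset.sum_eq_zero fun k _ => ?_
      rw [integral_add (i1 k) (i2 k), integral_const_mul, integral_const_mul, hφ0, hψ0]
      simp
    have hZsq : ∫ p, Z p ^ 2 ∂π = ∑ k, (t (.inl k) ^ 2 + 2 * s k * t (.inl k) * t (.inr k) +
        t (.inr k) ^ 2) := by
      have e : ∀ p, Z p ^ 2 = ∑ k, ∑ l, (t (.inl k) * t (.inl l) * (φ k p.1 * φ l p.1) +
          t (.inl k) * t (.inr l) * (φ k p.1 * ψ l p.2) +
          t (.inl l) * t (.inr k) * (φ l p.1 * ψ k p.2) +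
          t (.inr k) * t (.inr l) * (ψ k p.2 * ψ l p.2)) := fun p => by
        rw [sq, Finset.sum_mul_sum]
        exact Finset.sum_congr rfl fun k _ => Finset.sum_congr rfl fun l _ => by ring
      have j1 : ∀ k l, Integrable (fun p : E × E =>
          t (.inl k) * t (.inl l) * (φ k p.1 * φ l p.1)) π := fun k l =>
        ((hφ2 k).integrable_mul (hφ2 l)).const_mul _
      have j2 : ∀ k l, Integrable (fun p : E × E =>
          t (.inl k) * t (.inr l) * (φ k p.1 * ψ l p.2)) π := fun k l =>
        ((hφ2 k).integrable_mul (hψ2 l)).const_mul _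
      have j3 : ∀ k l, Integrable (fun p : E × E =>
          t (.inr k) * t (.inr l) * (ψ k p.2 * ψ l p.2)) π := fun k l =>
        ((hψ2 k).integrable_mul (hψ2 l)).const_mul _
      have j4 : ∀ k l, Integrable (fun p : E × E =>
          t (.inl k) * t (.inl l) * (φ k p.1 * φ l p.1) +
          t (.inl k) * t (.inr l) * (φ k p.1 * ψ l p.2)) π := fun k l => (j1 k l).add (j2 k l)
      have j5 : ∀ k l, Integrable (fun p : E × E =>
          t (.inl k) * t (.inl l) * (φ k p.1 * φ l p.1) +
          t (.inl k) * t (.inr l) * (φ k p.1 * ψ l p.2) +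
          t (.inl l) * t (.inr k) * (φ l p.1 * ψ k p.2)) π := fun k l => (j4 k l).add (j2 l k)
      have j6 : ∀ k l, Integrable (fun p : E × E =>
          t (.inl k) * t (.inl l) * (φ k p.1 * φ l p.1) +
          t (.inl k) * t (.inr l) * (φ k p.1 * ψ l p.2) +
          t (.inl l) * t (.inr k) * (φ l p.1 * ψ k p.2) +
          t (.inr k) * t (.inr l) * (ψ k p.2 * ψ l p.2)) π := fun k l => (j5 k l).add (j3 k l)
      simp_rw [e]
      rw [integral_finsetSum _ fun k _ => integrable_finsetSum _ fun l _ => j6 k l]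
      refine Finset.sum_congr rfl fun k _ => ?_
      rw [integral_finsetSum _ fun l _ => j6 k l]
      have e2 : ∀ l, ∫ p, (t (.inl k) * t (.inl l) * (φ k p.1 * φ l p.1) +
          t (.inl k) * t (.inr l) * (φ k p.1 * ψ l p.2) +
          t (.inl l) * t (.inr k) * (φ l p.1 * ψ k p.2) +
          t (.inr k) * t (.inr l) * (ψ k p.2 * ψ l p.2)) ∂π =
          if k = l then t (.inl k) ^ 2 + 2 * s k * t (.inl k) * t (.inr k) + t (.inr k) ^ 2
          else 0 := fun l => by
        rw [integral_add (j5 k l) (j3 k l), integral_add (j4 k l) (j2 l k),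
          integral_add (j1 k l) (j2 k l), integral_const_mul, integral_const_mul,
          integral_const_mul, integral_const_mul, hφφ, hφψ, hφψ, hψψ]
        by_cases hkl : k = l
        · subst hkl
          simp only [if_true]
          ring
        · simp [hkl, Ne.symm hkl]
      simp_rw [e2]
      simp
    have hclt := tendsto_integral_exp_normalizedSum π hZm hZ2 hZ0
    have hlim : charFun (lim : Measure (EuclideanSpace ℝ (K ⊕ K))) t =
        Complex.exp (-((∫ p, Z p ^ 2 ∂π : ℝ) : ℂ) / 2) := by
      rw [charFun_apply, ProbabilityMeasure.coe_mk, integral_map hT.aemeasurable (by fun_prop),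
        hZsq]
      have e : ∀ x : K → ℝ × ℝ, Complex.exp (((inner ℝ (pairsToEuclidean x) t : ℝ) : ℂ) *
          Complex.I) = ∏ k, Complex.exp
            (((t (.inl k) * (x k).1 + t (.inr k) * (x k).2 : ℝ) : ℂ) * Complex.I) := fun x => by
        rw [inner_pairsToEuclidean, ← Complex.exp_sum, Complex.ofReal_sum, Finset.sum_mul]
      simp_rw [e]
      rw [integral_fintype_prod_eq_prod (fun k (p : ℝ × ℝ) => Complex.exp
        (((t (.inl k) * p.1 + t (.inr k) * p.2 : ℝ) : ℂ) * Complex.I))]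
      simp_rw [charFun_correlatedGaussian (hs _)]
      rw [← Complex.exp_sum, ← Finset.sum_div, Finset.sum_neg_distrib, Complex.ofReal_sum]
    rw [hlim]
    refine hclt.congr fun N => ?_
    rw [charFun_apply, ProbabilityMeasure.coe_mk,
      integral_map (hTS N).aemeasurable (by fun_prop)]
    refine integral_congr_ae (Eventually.of_forall fun ω => ?_)
    simp only [inner_pairsToEuclidean]
    congr 3
    simp only [normalizedSums, splitSample, Z]
    rw [Finset.sum_range, Finset.sum_comm, Finset.mul_sum]
    refine Finset.sum_congr rfl fun k _ => ?_
    rw [Finset.sum_add_distrib, ← Finset.mul_sum, ← Finset.mul_sum]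
    ring
  -- A continuous left inverse of `pairsToEuclidean` turns the test function `h` into a bounded
  -- continuous function on the Euclidean space.
  let back : EuclideanSpace ℝ (K ⊕ K) → K → ℝ × ℝ := fun v k => (v (.inl k), v (.inr k))
  have hback : Continuous back := by fun_prop
  let H : BoundedContinuousFunction (EuclideanSpace ℝ (K ⊕ K)) ℝ :=
    BoundedContinuousFunction.ofNormedAddCommGroup (fun v => h (back v)) (hcont.comp hback) C
      fun v => hbound _
  have h2 := ProbabilityMeasure.tendsto_iff_forall_integral_tendsto.1 key H
  have hlim : ∫ v, H v ∂(lim : Measure (EuclideanSpace ℝ (K ⊕ K))) =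
      ∫ x, h x ∂Measure.pi fun k => correlatedGaussian (s k) := by
    rw [ProbabilityMeasure.coe_mk, integral_map hT.aemeasurable
      H.continuous.aestronglyMeasurable]
    rfl
  rw [hlim] at h2
  refine h2.congr fun N => ?_
  rw [ProbabilityMeasure.coe_mk, integral_map (hTS N).aemeasurable
    H.continuous.aestronglyMeasurable]
  exact (integral_map (measurable_splitSample N).aemeasurable
    (hcont.measurable.comp (measurable_normalizedSums hφ hψ N)).aestronglyMeasurable).symm

end CentralLimit

/-! ### Hilbert bases of eigenvectors of compact symmetric operators. -/

section Eigenbasis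

-- Bases of the eigenspaces are put together; the spectral theorem makes the union total. The first
-- component of an index is the eigenvalue.
open Module.End in
theorem exists_hilbertBasis_eigenvectors {H : Type*} [NormedAddCommGroup H] [InnerProductSpace ℝ H]
    [CompleteSpace H] (T : H →L[ℝ] H) (hT : IsCompactOperator T)
    (hT' : (T : H →ₗ[ℝ] H).IsSymmetric) :
    ∃ (w : ℝ → Set H) (b : HilbertBasis (Σ m, w m) ℝ H), ∀ i, T (b i) = i.1 • b i := by
  have hcl : ∀ m : ℝ, IsClosed (eigenspace (T : H →ₗ[ℝ] H) m : Set H) := fun m => by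
    have : (eigenspace (T : H →ₗ[ℝ] H) m : Set H) = {x | T x = m • x} := by
      ext x
      exact mem_eigenspace_iff
    rw [this]
    exact isClosed_eq T.continuous (by fun_prop)
  have hcomp : ∀ m : ℝ, CompleteSpace (eigenspace (T : H →ₗ[ℝ] H) m) :=
    fun m => (hcl m).completeSpace_coe
  choose v B hB using fun m : ℝ => exists_hilbertBasis ℝ (eigenspace (T : H →ₗ[ℝ] H) m)
  -- The index sets are transported from the eigenspaces to `H`, so that the index type no longer
  -- involves `T`.
  let w : ℝ → Set H := fun m => Subtype.val '' v m
  have he : ∀ m, Nonempty (v m ≃ w m) := fun m =>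
    ⟨Equiv.Set.image _ _ Subtype.val_injective⟩
  let q : ∀ m, w m → eigenspace (T : H →ₗ[ℝ] H) m := fun m a => B m ((he m).some.symm a)
  have horth : Orthonormal ℝ fun a : Σ m, w m => (q a.1 a.2 : H) :=
    hT'.orthogonalFamily_eigenspaces.orthonormal_sigma_orthonormal (v_family := q)
      fun m => (B m).orthonormal.comp _ (he m).some.symm.injective
  have hbot : (Submodule.span ℝ (Set.range fun a : Σ m, w m => (q a.1 a.2 : H)))ᗮ = ⊥ := by
    rw [eq_bot_iff, ← T.orthogonalComplement_iSup_eigenspaces_eq_bot hT hT',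
      ← Submodule.iInf_orthogonal]
    intro x hx
    rw [Submodule.mem_iInf]
    intro m
    rw [Submodule.mem_orthogonal]
    intro z hz
    have h1 := (((B m).hasSum_repr ⟨z, hz⟩).mapL (Submodule.subtypeL _)).mapL (innerSL ℝ x)
    have h2 : ∀ i, innerSL ℝ x ((eigenspace (T : H →ₗ[ℝ] H) m).subtypeL
        ((B m).repr ⟨z, hz⟩ i • B m i)) = 0 := fun i => by
      have h3 := (Submodule.mem_orthogonal' _ _).1 hx (B m i)
        (Submodule.subset_span ⟨⟨m, (he m).some i⟩, by simp [q]⟩)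
      simp [h3]
    simp only [h2] at h1
    rw [real_inner_comm]
    exact h1.unique hasSum_zero
  refine ⟨w, HilbertBasis.mkOfOrthogonalEqBot horth hbot, fun i => ?_⟩
  rw [HilbertBasis.coe_mkOfOrthogonalEqBot]
  exact mem_eigenspace_iff.1 (q i.1 i.2).2

/-- Orthonormal vectors are at distance √2, so the balls of radius 1/2 around them are disjoint open
sets. -/
theorem countable_of_orthonormal {H ι : Type*} [NormedAddCommGroup H] [InnerProductSpace ℝ H]
    [TopologicalSpace.SeparableSpace H] {v : ι → H} (hv : Orthonormal ℝ v) : Countable ι := by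
  refine Pairwise.countable_of_isOpen_disjoint (s := fun i => Metric.ball (v i) (1 / 2))
    (fun i j hij => Metric.ball_disjoint_ball ?_) (fun i => Metric.isOpen_ball)
    fun i => Metric.nonempty_ball.2 (by norm_num)
  have h : ‖v i - v j‖ ^ 2 = 2 := by
    rw [norm_sub_sq_real, hv.1, hv.1, hv.inner_eq_zero hij]
    norm_num
  rw [dist_eq_norm]
  nlinarith [norm_nonneg (v i - v j)]

end Eigenbasis

/-! ### Singular value decomposition of a Hilbert–Schmidt operator preserving the constants. -/

section KernelOperators

variable {α β : Type*} [MeasurableSpace α] [MeasurableSpace β]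
  {μ : Measure α} {ν : Measure β} [IsProbabilityMeasure μ] [IsProbabilityMeasure ν]

theorem memLp_two_mul_prod {α β : Type*} [MeasurableSpace α] [MeasurableSpace β]
    {μ : Measure α} {ν : Measure β} [SFinite μ] [SFinite ν] {f : α → ℝ} {g : β → ℝ}
    (hf : MemLp f 2 μ) (hg : MemLp g 2 ν) :
    MemLp (fun z : α × β => f z.1 * g z.2) 2 (μ.prod ν) := by
  refine (memLp_two_iff_integrable_sq (hf.1.comp_fst.mul hg.1.comp_snd)).2 ?_
  simp only [Pi.mul_apply]
  simp_rw [mul_pow]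
  exact hf.integrable_sq.mul_prod hg.integrable_sq

theorem inner_Lp_eq_integral {α : Type*} [MeasurableSpace α] {μ : Measure α} (f g : Lp ℝ 2 μ) :
    inner ℝ f g = ∫ x, f x * g x ∂μ := by
  rw [L2.inner_def]
  simp only [RCLike.inner_apply, conj_trivial, mul_comm]

theorem integral_mul_kernel {k : α × β → ℝ} (hk : MemLp k 2 (μ.prod ν)) (f : Lp ℝ 2 μ)
    (g : Lp ℝ 2 ν) :
    ∫ z, f z.1 * g z.2 * k z ∂μ.prod ν = inner ℝ (kernelOperator k hk f) g := by
  have hint : Integrable (fun z : α × β => f z.1 * g z.2 * k z) (μ.prod ν) :=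
    (memLp_two_mul_prod (Lp.memLp f) (Lp.memLp g)).integrable_mul hk
  rw [inner_Lp_eq_integral, integral_prod_symm _ hint]
  refine integral_congr_ae ?_
  filter_upwards [kernelOperator_ae_eq k hk f] with y hy
  rw [hy, ← integral_mul_const]
  refine integral_congr_ae (Eventually.of_forall fun x => ?_)
  simp only
  ring

theorem ae_memLp_kernel_section {k : α × β → ℝ} (hk : MemLp k 2 (μ.prod ν)) :
    ∀ᵐ y ∂ν, MemLp (fun x => k (x, y)) 2 μ := by
  have hk' : AEStronglyMeasurable (fun z : β × α => k z.swap) (ν.prod μ) := hk.1.prod_swap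
  filter_upwards [hk'.prodMk_left, hk.integrable_sq.prod_left_ae] with y h1 h2
  exact (memLp_two_iff_integrable_sq h1).2 h2

/-- Parseval's identity for a Hilbert–Schmidt operator. -/
theorem hasSum_norm_sq_kernelOperator {ι : Type*} [Countable ι] (b : HilbertBasis ι ℝ (Lp ℝ 2 μ))
    {k : α × β → ℝ} (hk : MemLp k 2 (μ.prod ν)) :
    HasSum (fun i => ‖kernelOperator k hk (b i)‖ ^ 2) (∫ z, k z ^ 2 ∂μ.prod ν) := by
  have hA : ∀ i, ‖kernelOperator k hk (b i)‖ ^ 2 = ∫ y, kernelOperator k hk (b i) y ^ 2 ∂ν :=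
    fun i => by
    rw [← real_inner_self_eq_norm_sq, inner_Lp_eq_integral]
    simp_rw [sq]
  have hAi : ∀ i, Integrable (fun y => kernelOperator k hk (b i) y ^ 2) ν :=
    fun i => (Lp.memLp _).integrable_sq
  -- For almost every `y`, the values at `y` of the images of the basis are the coefficients of the
  -- section `k (·, y)`; Parseval is applied to that section and then integrated in `y`.
  have h1 : ∀ᵐ y ∂ν, ∑' i, ENNReal.ofReal (kernelOperator k hk (b i) y ^ 2) =
      ∫⁻ x, ENNReal.ofReal (k (x, y) ^ 2) ∂μ := by
    filter_upwards [ae_memLp_kernel_section hk,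
      ae_all_iff.2 fun i => kernelOperator_ae_eq k hk (b i)] with y hy hyA
    have h2 := b.hasSum_inner_mul_inner (hy.toLp _) (hy.toLp _)
    have h3 : ∀ i, inner ℝ (hy.toLp _) (b i) = kernelOperator k hk (b i) y := fun i => by
      rw [hyA, inner_Lp_eq_integral]
      refine integral_congr_ae ?_
      filter_upwards [hy.coeFn_toLp] with x hx
      rw [hx, mul_comm]
    have h4 : inner ℝ (hy.toLp _) (hy.toLp _) = ∫ x, k (x, y) ^ 2 ∂μ := by
      rw [inner_Lp_eq_integral]
      refine integral_congr_ae ?_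
      filter_upwards [hy.coeFn_toLp] with x hx
      rw [hx, sq]
    have h5 : HasSum (fun i => kernelOperator k hk (b i) y ^ 2) (∫ x, k (x, y) ^ 2 ∂μ) := by
      rw [← h4]
      have h6 : ∀ i, inner ℝ (hy.toLp _) (b i) * inner ℝ (b i) (hy.toLp _) =
          kernelOperator k hk (b i) y ^ 2 := fun i => by
        rw [real_inner_comm (hy.toLp _) (b i), h3, sq]
      simp only [h6] at h2
      exact h2
    rw [← ENNReal.ofReal_tsum_of_nonneg (fun i => sq_nonneg _) h5.summable, h5.tsum_eq,
      ofReal_integral_eq_lintegral_ofReal hy.integrable_sq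
        (Eventually.of_forall fun x => sq_nonneg _)]
  have hkm : AEMeasurable (fun z => ENNReal.ofReal (k z ^ 2)) (μ.prod ν) :=
    (hk.1.aemeasurable.pow_const 2).ennreal_ofReal
  have h2 : ∑' i, ENNReal.ofReal (‖kernelOperator k hk (b i)‖ ^ 2) =
      ENNReal.ofReal (∫ z, k z ^ 2 ∂μ.prod ν) := by
    rw [ofReal_integral_eq_lintegral_ofReal hk.integrable_sq
        (Eventually.of_forall fun x => sq_nonneg _),
      lintegral_prod_symm _ hkm, ← lintegral_congr_ae h1,
      lintegral_tsum fun i => (hAi i).aemeasurable.ennreal_ofReal]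
    refine tsum_congr fun i => ?_
    rw [hA, ofReal_integral_eq_lintegral_ofReal (hAi i) (Eventually.of_forall fun x => sq_nonneg _)]
  have h3 : Summable fun i => ‖kernelOperator k hk (b i)‖ ^ 2 := by
    have := ENNReal.summable_toReal (h2.trans_ne ENNReal.ofReal_ne_top)
    simpa only [ENNReal.toReal_ofReal (sq_nonneg _)] using this
  have h4 := congrArg ENNReal.toReal h2
  rw [ENNReal.tsum_toReal_eq fun _ => ENNReal.ofReal_ne_top,
    ENNReal.toReal_ofReal (integral_nonneg fun _ => sq_nonneg _)] at h4
  simp only [ENNReal.toReal_ofReal (sq_nonneg _)] at h4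
  exact h4 ▸ h3.hasSum

/-- The functions `φ i` and `ψ i`, with the coefficients `s i`, are the nonconstant part of the
singular value decomposition of the operator of kernel `k`, whose leading part is the constant `1`,
and the singular values `s i` are bounded away from `1`. -/
structure IsSingularSystem {ι : Type*} [DecidableEq ι] (μ : Measure α) (ν : Measure β)
    (k : α × β → ℝ) (φ : ι → α → ℝ) (ψ : ι → β → ℝ) (s : ι → ℝ) (r : ℝ) : Prop where
  lt_one : r < 1
  sq_le : ∀ i, s i ^ 2 ≤ r
  measurable_left : ∀ i, Measurable (φ i)
  measurable_right : ∀ i, Measurable (ψ i)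
  memLp_left : ∀ i, MemLp (φ i) 2 μ
  memLp_right : ∀ i, MemLp (ψ i) 2 ν
  integral_left : ∀ i, ∫ x, φ i x ∂μ = 0
  integral_right : ∀ i, ∫ y, ψ i y ∂ν = 0
  orthonormal_left : ∀ i j, ∫ x, φ i x * φ j x ∂μ = if i = j then 1 else 0
  orthonormal_right : ∀ i j, ∫ y, ψ i y * ψ j y ∂ν = if i = j then 1 else 0
  integral_kernel : ∀ i j, ∫ z, φ i z.1 * ψ j z.2 * k z ∂μ.prod ν = if i = j then s i else 0
  hasSum_sq : HasSum (fun i => s i ^ 2) (∫ z, k z ^ 2 ∂μ.prod ν - 1)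

-- Take an eigenbasis `b` of `T = A* A` and set `φ i = b i`, `s i = √λ_i`, `ψ i = A (b i) / s i`,
-- keeping the indices with `λ_i > 0` and `b i` orthogonal to the constants. The gap bounds these
-- eigenvalues by `r`; it also forces any basis vector not orthogonal to the constants to be `±1`,
-- so the discarded indices account exactly for the constant part.
open Classical in
theorem exists_isSingularSystem [MeasurableSpace.CountablyGenerated α] {k : α × β → ℝ}
    (hk : MemLp k 2 (μ.prod ν)) (hcompact : IsCompactOperator (kernelOperator k hk))
    (hone : kernelOperator k hk (Lp.const 2 μ 1) = Lp.const 2 ν 1)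
    (hone' : (kernelOperator k hk).adjoint (Lp.const 2 ν 1) = Lp.const 2 μ 1)
    (hgap : HasEigenvalueGap ((kernelOperator k hk).adjoint ∘L kernelOperator k hk)
      (Lp.const 2 μ (1 : ℝ))) :
    ∃ (w : ℝ → Set (Lp ℝ 2 μ)) (P : (Σ m, w m) → Prop) (φ : {i // P i} → α → ℝ)
      (ψ : {i // P i} → β → ℝ) (s : {i // P i} → ℝ) (r : ℝ),
      Countable {i // P i} ∧ IsSingularSystem μ ν k φ ψ s r := by
  set A := kernelOperator k hk with hA
  set u : Lp ℝ 2 μ := Lp.const 2 μ 1 with hu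
  set u' : Lp ℝ 2 ν := Lp.const 2 ν 1 with hu'
  set T := A.adjoint ∘L A with hT
  have hTA : ∀ f g, inner ℝ (T f) g = inner ℝ (A f) (A g) := fun f g => by
    rw [hT, ContinuousLinearMap.comp_apply, ContinuousLinearMap.adjoint_inner_left]
  have hsymm : (T : Lp ℝ 2 μ →ₗ[ℝ] Lp ℝ 2 μ).IsSymmetric := fun f g => by
    rw [ContinuousLinearMap.coe_coe, hTA, real_inner_comm, ← hTA, real_inner_comm]
  have hTu : T u = u := by rw [hT, ContinuousLinearMap.comp_apply, hone, hone']
  have hu_norm : inner ℝ u u = 1 := by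
    rw [inner_Lp_eq_integral, integral_congr_ae (g := fun _ => (1 : ℝ))]
    · simp
    · filter_upwards [Lp.coeFn_const 2 μ (1 : ℝ)] with x hx
      rw [hx]
      simp
  have hu_inner : ∀ f : Lp ℝ 2 μ, inner ℝ u f = ∫ x, f x ∂μ := fun f => by
    rw [inner_Lp_eq_integral]
    refine integral_congr_ae ?_
    filter_upwards [Lp.coeFn_const 2 μ (1 : ℝ)] with x hx
    rw [hx]
    simp
  have hu_inner' : ∀ f : Lp ℝ 2 ν, inner ℝ u' f = ∫ x, f x ∂ν := fun f => by
    rw [inner_Lp_eq_integral]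
    refine integral_congr_ae ?_
    filter_upwards [Lp.coeFn_const 2 ν (1 : ℝ)] with x hx
    rw [hx]
    simp
  obtain ⟨w, b, hb⟩ := exists_hilbertBasis_eigenvectors T
    (hcompact.clm_comp A.adjoint) hsymm
  obtain ⟨r, hr, hgap⟩ := hgap
  have : Fact ((2 : ℝ≥0∞) ≠ ∞) := ⟨by norm_num⟩
  -- Separability of L², which comes from the countably generated σ-algebra, makes the basis
  -- countable.
  have : Countable (Σ m, w m) := countable_of_orthonormal b.orthonormal
  have hb1 : ∀ i, inner ℝ (b i) (b i) = (1 : ℝ) := fun i => by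
    rw [real_inner_self_eq_norm_sq, b.orthonormal.1]
    norm_num
  have hl : ∀ i, i.1 = ‖A (b i)‖ ^ 2 := fun i => by
    rw [← real_inner_self_eq_norm_sq, ← hTA, hb, real_inner_smul_left, hb1, mul_one]
  have hAA : ∀ i j, inner ℝ (A (b i)) (A (b j)) = if i = j then i.1 else 0 := fun i j => by
    rw [← hTA, hb, real_inner_smul_left]
    split_ifs with h
    · rw [← h, hb1, mul_one]
    · rw [b.orthonormal.inner_eq_zero h, mul_zero]
  -- an eigenvector which is not orthogonal to the constants is constant
  have hne : ∀ i, inner ℝ u (b i) ≠ 0 → i.1 = 1 ∧ inner ℝ u (b i) ^ 2 = 1 := fun i hi => by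
    have h1 : i.1 = 1 := by
      have h2 := hsymm u (b i)
      rw [ContinuousLinearMap.coe_coe, hTu, hb, real_inner_smul_right] at h2
      exact mul_right_cancel₀ hi (by rw [one_mul, ← h2])
    refine ⟨h1, ?_⟩
    have h3 : b i - inner ℝ u (b i) • u = 0 := by
      by_contra h
      have := hgap 1 _ h (by rw [inner_sub_right, real_inner_smul_right, hu_norm]; ring)
        (by rw [map_sub, map_smul, hTu, hb, h1, one_smul, one_smul])
      linarith
    have h4 := hb1 i
    rw [sub_eq_zero.1 h3, real_inner_smul_left, real_inner_smul_right, hu_norm] at h4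
    rw [sq]
    linarith
  -- Subtracting Parseval for the unit vector `u` from the Hilbert–Schmidt sum removes the constant
  -- mode without having to locate its index.
  have hsum : HasSum (fun i => i.1 - inner ℝ u (b i) ^ 2) (∫ z, k z ^ 2 ∂μ.prod ν - 1) := by
    have h1 := hasSum_norm_sq_kernelOperator b hk
    have h2 := b.hasSum_inner_mul_inner u u
    rw [hu_norm] at h2
    have h3 : ∀ i, inner ℝ u (b i) * inner ℝ (b i) u = inner ℝ u (b i) ^ 2 := fun i => by
      rw [sq, real_inner_comm u (b i)]
    have h4 := h1.sub h2
    simp only [h3, ← hA, ← hl] at h4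
    exact h4
  let P : (Σ m, w m) → Prop := fun i => inner ℝ u (b i) = 0 ∧ 0 < i.1
  have hs : ∀ i : {i // P i}, 0 < √i.1.1 := fun i => Real.sqrt_pos.2 i.2.2
  have hs2 : ∀ i : {i // P i}, √i.1.1 ^ 2 = i.1.1 := fun i => Real.sq_sqrt i.2.2.le
  refine ⟨w, P, fun i => b i.1, fun i => ((√i.1.1)⁻¹ • A (b i.1) : Lp ℝ 2 ν), fun i => √i.1.1, r,
    inferInstance, ?_⟩
  refine
    { lt_one := hr
      sq_le := fun i => ?_
      measurable_left := fun i => (Lp.stronglyMeasurable _).measurable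
      measurable_right := fun i => (Lp.stronglyMeasurable _).measurable
      memLp_left := fun i => Lp.memLp _
      memLp_right := fun i => Lp.memLp _
      integral_left := fun i => ?_
      integral_right := fun i => ?_
      orthonormal_left := fun i j => ?_
      orthonormal_right := fun i j => ?_
      integral_kernel := fun i j => ?_
      hasSum_sq := ?_ }
  · rw [hs2]
    refine hgap _ (b i.1) (b.orthonormal.ne_zero _) i.2.1 (hb _)
  · rw [← hu_inner, i.2.1]
  · rw [← hu_inner', real_inner_smul_right, ← ContinuousLinearMap.adjoint_inner_left, hone',
      i.2.1, mul_zero]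
  · rw [← inner_Lp_eq_integral]
    split_ifs with h
    · rw [h, hb1]
    · exact b.orthonormal.inner_eq_zero fun h' => h (Subtype.ext h')
  · rw [← inner_Lp_eq_integral, real_inner_smul_left, real_inner_smul_right, hAA]
    by_cases h : i = j
    · subst h
      rw [if_pos rfl, if_pos rfl, ← mul_assoc, ← mul_inv, ← sq, hs2, inv_mul_cancel₀ i.2.2.ne']
    · rw [if_neg h, if_neg fun h' => h (Subtype.ext h')]
      ring
  · rw [integral_mul_kernel hk, real_inner_smul_right, hAA]
    by_cases h : i = j
    · subst h
      rw [if_pos rfl, if_pos rfl]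
      nth_rw 2 [← hs2 i]
      field_simp
    · rw [if_neg h, if_neg fun h' => h (Subtype.ext h'), mul_zero]
  · simp_rw [hs2]
    have h1 : ∀ i, i ∉ Set.range (Subtype.val : {i // P i} → Σ m, w m) →
        i.1 - inner ℝ u (b i) ^ 2 = 0 := fun i hi => by
      by_cases h : inner ℝ u (b i) = 0
      · rw [h]
        have h2 : ¬ 0 < i.1 := fun h' => hi ⟨⟨i, h, h'⟩, rfl⟩
        have h3 : 0 ≤ i.1 := by rw [hl]; positivity
        linarith
      · rw [(hne i h).1, (hne i h).2, sub_self]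
    rw [← Subtype.val_injective.hasSum_iff h1] at hsum
    have h2 : ∀ i : {i // P i}, i.1.1 - inner ℝ u (b i.1) ^ 2 = i.1.1 := fun i => by
      simp [i.2.1]
    simp only [Function.comp_def, h2] at hsum
    exact hsum

end KernelOperators

theorem integral_comp_measurePreserving {α β : Type*} [MeasurableSpace α] [MeasurableSpace β]
    {μ : Measure α} {ν : Measure β} {T : α → β} (hT : MeasurePreserving T μ ν) {f : β → ℝ}
    (hf : AEStronglyMeasurable f ν) : ∫ x, f (T x) ∂μ = ∫ y, f y ∂ν := by
  obtain ⟨hT, rfl⟩ := hT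
  exact (integral_map hT.aemeasurable hf).symm

/-! ### Consequences of a singular system: products, approximation, second moment, limit laws. -/

section SingularSystem

variable {E : Type*} [MeasurableSpace E] {ρ₀ ρ₁ : Measure E} [IsProbabilityMeasure ρ₀]
  [IsProbabilityMeasure ρ₁] {k : E × E → ℝ} {ι : Type*} [DecidableEq ι] {φ ψ : ι → E → ℝ}
  {s : ι → ℝ} {r : ℝ}

namespace IsSingularSystem

theorem sq_lt_one {α β : Type*} [MeasurableSpace α] [MeasurableSpace β] {μ : Measure α}
    {ν : Measure β} {k : α × β → ℝ} {φ : ι → α → ℝ} {ψ : ι → β → ℝ}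
    (S : IsSingularSystem μ ν k φ ψ s r) (i : ι) : s i ^ 2 < 1 :=
  (S.sq_le i).trans_lt S.lt_one

theorem sum_sq_div_le {ρ₀ ρ₁ : Measure E} (S : IsSingularSystem ρ₀ ρ₁ k φ ψ s r) (K : Finset ι) :
    ∑ i ∈ K, s i ^ 2 / (1 - s i ^ 2) ≤ (∫ z, k z ^ 2 ∂ρ₀.prod ρ₁ - 1) / (1 - r) := by
  have hr : 0 < 1 - r := by linarith [S.lt_one]
  have h : ∑ i ∈ K, s i ^ 2 / (1 - s i ^ 2) ≤ ∑ i ∈ K, s i ^ 2 / (1 - r) :=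
    Finset.sum_le_sum fun i _ =>
      div_le_div_of_nonneg_left (sq_nonneg _) hr (by linarith [S.sq_le i])
  refine h.trans ?_
  rw [← Finset.sum_div]
  exact div_le_div_of_nonneg_right (sum_le_hasSum K (fun i _ => sq_nonneg _) S.hasSum_sq) hr.le

theorem bddAbove_prod {ρ₀ ρ₁ : Measure E} (S : IsSingularSystem ρ₀ ρ₁ k φ ψ s r) :
    BddAbove (Set.range fun K : Finset ι => ∏ i ∈ K, (1 - s i ^ 2)⁻¹) := by
  refine ⟨Real.exp ((∫ z, k z ^ 2 ∂ρ₀.prod ρ₁ - 1) / (1 - r)), ?_⟩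
  rintro _ ⟨K, rfl⟩
  refine le_trans ?_ (Real.exp_le_exp.2 (S.sum_sq_div_le K))
  rw [Real.exp_sum]
  refine Finset.prod_le_prod (fun i _ => inv_nonneg.2 (by linarith [S.sq_lt_one i])) fun i _ => ?_
  have h : 0 < 1 - s i ^ 2 := by linarith [S.sq_lt_one i]
  -- With `x = s i ^ 2`, `(1 - x)⁻¹ = 1 + x / (1 - x) ≤ exp (x / (1 - x))`.
  refine le_trans (le_of_eq ?_) (Real.add_one_le_exp _)
  field_simp
  ring

/-- The coefficients of a singular system, completed by the leading coefficient `1`. -/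
def coeff {ι : Type*} (s : ι → ℝ) (K : Finset ι)
    (j : Option K) : ℝ := j.elim 1 fun i => s i

/-- The functions of a singular system, completed by the constant function `1`. -/
def fn {E ι : Type*} (φ : ι → E → ℝ) (K : Finset ι)
    (j : Option K) : E → ℝ := j.elim 1 fun i => φ i

/-- The truncation of the singular value decomposition to the indices in `K`. -/
def partialKernel {E ι : Type*} (φ ψ : ι → E → ℝ) (s : ι → ℝ) (K : Finset ι) (z : E × E) : ℝ :=
  ∑ j, coeff s K j * (fn φ K j z.1 * fn ψ K j z.2)

theorem memLp_fn {ι : Type*} {φ : ι → E → ℝ} {μ : Measure E} [IsProbabilityMeasure μ]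
    (h : ∀ i, MemLp (φ i) 2 μ)
    (K : Finset ι)
    (j : Option K) : MemLp (fn φ K j) 2 μ := by
  cases j with
  | none => exact memLp_const 1
  | some i => exact h i

theorem measurable_fn {ι : Type*} {φ : ι → E → ℝ} (h : ∀ i, Measurable (φ i)) (K : Finset ι)
    (j : Option K) :
    Measurable (fn φ K j) := by
  cases j with
  | none => exact measurable_const
  | some i => exact h i

theorem orthonormal_fn {μ : Measure E} [IsProbabilityMeasure μ] (h0 : ∀ i, ∫ x, φ i x ∂μ = 0)
    (h : ∀ i j, ∫ x, φ i x * φ j x ∂μ = if i = j then 1 else 0) (K : Finset ι) (a b : Option K) :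
    ∫ x, fn φ K a x * fn φ K b x ∂μ = if a = b then 1 else 0 := by
  cases a <;> cases b <;> simp [fn, h0, h]

/-- The truncation is an orthogonal projection of `k`: its square norm and its inner product with
`k` are both the sum of the squared coefficients. The leading coefficient is 1 because `k` has
integral 1. -/
theorem integral_sub_partialKernel_sq (S : IsSingularSystem ρ₀ ρ₁ k φ ψ s r)
    (hk : MemLp k 2 (ρ₀.prod ρ₁)) (hk1 : ∫ z, k z ∂ρ₀.prod ρ₁ = 1) (K : Finset ι) :
    MemLp (fun z => k z - partialKernel φ ψ s K z) 2 (ρ₀.prod ρ₁) ∧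
    ∫ z, (k z - partialKernel φ ψ s K z) ^ 2 ∂ρ₀.prod ρ₁ =
      ∫ z, k z ^ 2 ∂ρ₀.prod ρ₁ - 1 - ∑ i ∈ K, s i ^ 2 := by
  have hφ := memLp_fn S.memLp_left K
  have hψ := memLp_fn S.memLp_right K
  have hj : ∀ j, MemLp (fun z : E × E => fn φ K j z.1 * fn ψ K j z.2) 2 (ρ₀.prod ρ₁) := fun j =>
    memLp_two_mul_prod (hφ j) (hψ j)
  have hp : MemLp (partialKernel φ ψ s K) 2 (ρ₀.prod ρ₁) :=
    memLp_finsetSum _ fun j _ => (hj j).const_mul _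
  have h2 : ∑ j, coeff s K j ^ 2 = 1 + ∑ i ∈ K, s i ^ 2 := by
    rw [Fintype.sum_option]
    simp only [coeff, Option.elim_none, Option.elim_some, one_pow]
    rw [Finset.sum_coe_sort K fun i => s i ^ 2]
  have hpp : ∫ z, partialKernel φ ψ s K z ^ 2 ∂ρ₀.prod ρ₁ = ∑ j, coeff s K j ^ 2 := by
    refine (integral_sq_sum_of_orthonormal (P := ρ₀.prod ρ₁)
      (h := fun j (z : E × E) => fn φ K j z.1 * fn ψ K j z.2)
      (fun a b => (hj a).integrable_mul (hj b)) (fun a b => ?_) (coeff s K)).2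
    have h3 := integral_prod_mul (μ := ρ₀) (ν := ρ₁) (fun x => fn φ K a x * fn φ K b x)
      (fun y => fn ψ K a y * fn ψ K b y)
    rw [orthonormal_fn S.integral_left S.orthonormal_left,
      orthonormal_fn S.integral_right S.orthonormal_right] at h3
    have h4 : (if a = b then (1 : ℝ) else 0) =
        (if a = b then 1 else 0) * (if a = b then 1 else 0) := by split_ifs <;> simp
    rw [h4, ← h3]
    refine integral_congr_ae (Eventually.of_forall fun z => ?_)
    simp only
    ring
  have hjk : ∀ j, Integrable (fun z : E × E => fn φ K j z.1 * fn ψ K j z.2 * k z)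
      (ρ₀.prod ρ₁) := fun j => (hj j).integrable_mul hk
  have hkp : ∫ z, partialKernel φ ψ s K z * k z ∂ρ₀.prod ρ₁ = ∑ j, coeff s K j ^ 2 := by
    have e : ∀ z, partialKernel φ ψ s K z * k z =
        ∑ j, coeff s K j * (fn φ K j z.1 * fn ψ K j z.2 * k z) := fun z => by
      rw [partialKernel, Finset.sum_mul]
      exact Finset.sum_congr rfl fun j _ => by ring
    simp_rw [e]
    rw [integral_finsetSum _ fun j _ => (hjk j).const_mul _]
    refine Finset.sum_congr rfl fun j _ => ?_
    rw [integral_const_mul, sq]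
    congr 1
    cases j with
    | none => simp [fn, coeff, hk1]
    | some i => simp [fn, coeff, S.integral_kernel]
  refine ⟨hk.sub hp, ?_⟩
  have e : ∀ z, (k z - partialKernel φ ψ s K z) ^ 2 =
      k z ^ 2 - 2 * (partialKernel φ ψ s K z * k z) + partialKernel φ ψ s K z ^ 2 :=
    fun z => by ring
  have i1 : Integrable (fun z => 2 * (partialKernel φ ψ s K z * k z)) (ρ₀.prod ρ₁) :=
    (hp.integrable_mul hk).const_mul 2
  have i2 : Integrable (fun z => k z ^ 2 - 2 * (partialKernel φ ψ s K z * k z)) (ρ₀.prod ρ₁) :=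
    hk.integrable_sq.sub i1
  simp_rw [e]
  rw [integral_add i2 hp.integrable_sq, integral_sub hk.integrable_sq i1, integral_const_mul, hkp,
    hpp, h2]
  ring

/-- Mean square convergence along finite sets gives almost sure convergence along a sequence of
them, the form needed for Fatou's lemma. -/
theorem exists_seq_partialKernel [Countable ι] (S : IsSingularSystem ρ₀ ρ₁ k φ ψ s r)
    (hk : MemLp k 2 (ρ₀.prod ρ₁)) (hk1 : ∫ z, k z ∂ρ₀.prod ρ₁ = 1) :
    ∃ K : ℕ → Finset ι, ∀ᵐ z ∂ρ₀.prod ρ₁,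
      Tendsto (fun n => partialKernel φ ψ s (K n) z) atTop (𝓝 (k z)) := by
  have h1 : Tendsto (fun K : Finset ι => eLpNorm (partialKernel φ ψ s K - k) 2 (ρ₀.prod ρ₁))
      atTop (𝓝 0) := by
    have h2 : Tendsto (fun K : Finset ι => ENNReal.ofReal (√(∫ z, k z ^ 2 ∂ρ₀.prod ρ₁ - 1 -
        ∑ i ∈ K, s i ^ 2))) atTop (𝓝 (ENNReal.ofReal (√(∫ z, k z ^ 2 ∂ρ₀.prod ρ₁ - 1 -
        (∫ z, k z ^ 2 ∂ρ₀.prod ρ₁ - 1))))) :=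
      (ENNReal.continuous_ofReal.tendsto _).comp ((Real.continuous_sqrt.tendsto _).comp
        (tendsto_const_nhds.sub S.hasSum_sq))
    rw [sub_self, Real.sqrt_zero, ENNReal.ofReal_zero] at h2
    refine h2.congr fun K => ?_
    have h3 := S.integral_sub_partialKernel_sq hk hk1 K
    rw [← h3.2, eLpNorm_sub_comm]
    refine Eq.trans ?_ (h3.1.eLpNorm_eq_integral_rpow_norm two_ne_zero ENNReal.ofNat_ne_top).symm
    simp [Real.sqrt_eq_rpow]
  have hm : ∀ K, AEStronglyMeasurable (partialKernel φ ψ s K) (ρ₀.prod ρ₁) := fun K =>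
    ((hk.sub (S.integral_sub_partialKernel_sq hk hk1 K).1).1).congr
      (Eventually.of_forall fun z => by simp)
  obtain ⟨K, -, hK⟩ := (tendstoInMeasure_of_tendsto_eLpNorm two_ne_zero hm hk.1
    h1).exists_seq_tendsto_ae'
  exact ⟨K, hK⟩

theorem measurePreserving_samplePair_eval (ρ₀ ρ₁ : Measure E) [IsProbabilityMeasure ρ₀]
    [IsProbabilityMeasure ρ₁] {N : ℕ} (i j : Fin N) :
    MeasurePreserving (fun z : (Fin N → E) × (Fin N → E) => (z.1 i, z.2 j))
      (samplePair ρ₀ ρ₁ N) (ρ₀.prod ρ₁) :=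
  (measurePreserving_eval (fun _ : Fin N => ρ₀) i).prod
    (measurePreserving_eval (fun _ : Fin N => ρ₁) j)

/-- The second moment of the average over pairings, in the presence of a singular system. -/
theorem integral_pairingAverage_sq_le [Countable ι] (S : IsSingularSystem ρ₀ ρ₁ k φ ψ s r)
    (hkm : Measurable k) (hk : MemLp k 2 (ρ₀.prod ρ₁)) (hk1 : ∫ z, k z ∂ρ₀.prod ρ₁ = 1) (N : ℕ) :
    MemLp (pairingAverage k N) 2 (samplePair ρ₀ ρ₁ N) ∧
    ∫ z, pairingAverage k N z ^ 2 ∂samplePair ρ₀ ρ₁ N ≤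
      ⨆ K : Finset ι, ∏ i ∈ K, (1 - s i ^ 2)⁻¹ := by
  set C := ⨆ K : Finset ι, ∏ i ∈ K, (1 - s i ^ 2)⁻¹ with hC
  have hC0 : 0 ≤ C := le_trans (by simp) (le_ciSup S.bddAbove_prod (∅ : Finset ι))
  obtain ⟨K, hK⟩ := S.exists_seq_partialKernel hk hk1
  have hpm : ∀ K : Finset ι, Measurable (partialKernel φ ψ s K) := fun K =>
    Finset.measurable_sum _ fun j _ =>
      (((measurable_fn S.measurable_left K j).comp measurable_fst).mul
        ((measurable_fn S.measurable_right K j).comp measurable_snd)).const_mul _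
  have hlim : ∀ᵐ z ∂samplePair ρ₀ ρ₁ N, Tendsto
      (fun n => ENNReal.ofReal (pairingAverage (partialKernel φ ψ s (K n)) N z ^ 2)) atTop
      (𝓝 (ENNReal.ofReal (pairingAverage k N z ^ 2))) := by
    -- The two samples are independent, so every pair of entries, matched or not, has law `ρ₀.prod
    -- ρ₁`, and the convergence holds for all these pairs at once.
    have h : ∀ᵐ z ∂samplePair ρ₀ ρ₁ N, ∀ i j : Fin N, Tendsto
        (fun n => partialKernel φ ψ s (K n) (z.1 i, z.2 j)) atTop (𝓝 (k (z.1 i, z.2 j))) :=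
      ae_all_iff.2 fun i => ae_all_iff.2 fun j =>
        (measurePreserving_samplePair_eval ρ₀ ρ₁ i j).quasiMeasurePreserving.ae hK
    filter_upwards [h] with z hz
    refine (ENNReal.continuous_ofReal.tendsto _).comp (Tendsto.pow ?_ 2)
    exact tendsto_const_nhds.mul (tendsto_finsetSum _ fun σ _ => tendsto_finsetProd _ fun i _ =>
      hz i (σ i))
  have hbound : ∀ n, ∫⁻ z, ENNReal.ofReal (pairingAverage (partialKernel φ ψ s (K n)) N z ^ 2)
      ∂samplePair ρ₀ ρ₁ N ≤ ENNReal.ofReal C := fun n => by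
    have h : Integrable (fun z => pairingAverage (partialKernel φ ψ s (K n)) N z ^ 2)
        (samplePair ρ₀ ρ₁ N) ∧
        ∫ z, pairingAverage (partialKernel φ ψ s (K n)) N z ^ 2 ∂samplePair ρ₀ ρ₁ N ≤
          ∏ i, (1 - coeff s (K n) (some i) ^ 2)⁻¹ :=
        _root_.integral_pairingAverage_sq_le (t := coeff s (K n))
      (memLp_fn S.memLp_left (K n)) (memLp_fn S.memLp_right (K n))
      (orthonormal_fn S.integral_left S.orthonormal_left (K n))
      (orthonormal_fn S.integral_right S.orthonormal_right (K n)) rfl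
      (fun i => S.sq_lt_one i) N
    rw [← ofReal_integral_eq_lintegral_ofReal h.1 (Eventually.of_forall fun _ => sq_nonneg _)]
    refine ENNReal.ofReal_le_ofReal (h.2.trans ?_)
    refine le_trans (le_of_eq ?_) (le_ciSup S.bddAbove_prod (K n))
    exact Finset.prod_coe_sort (K n) fun i => (1 - s i ^ 2)⁻¹
  -- Fatou's lemma carries the bound for kernels of finite rank over to `k`.
  have hle : ∫⁻ z, ENNReal.ofReal (pairingAverage k N z ^ 2) ∂samplePair ρ₀ ρ₁ N ≤
      ENNReal.ofReal C := by
    calc _ = ∫⁻ z, liminf (fun n => ENNReal.ofReal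
            (pairingAverage (partialKernel φ ψ s (K n)) N z ^ 2)) atTop ∂samplePair ρ₀ ρ₁ N :=
          lintegral_congr_ae (hlim.mono fun z hz => hz.liminf_eq.symm)
      _ ≤ liminf (fun n => ∫⁻ z, ENNReal.ofReal
            (pairingAverage (partialKernel φ ψ s (K n)) N z ^ 2) ∂samplePair ρ₀ ρ₁ N) atTop :=
          lintegral_liminf_le fun n =>
            ((measurable_pairingAverage (hpm _) N).pow_const 2).ennreal_ofReal
      _ ≤ liminf (fun _ : ℕ => ENNReal.ofReal C) atTop :=
          liminf_le_liminf (Eventually.of_forall hbound)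
      _ = _ := liminf_const _
  have hm := measurable_pairingAverage hkm N
  refine ⟨(memLp_two_iff_integrable_sq hm.aestronglyMeasurable).2
    ⟨(hm.pow_const 2).aestronglyMeasurable, ?_⟩, ?_⟩
  · rw [hasFiniteIntegral_iff_ofReal (Eventually.of_forall fun _ => sq_nonneg _)]
    exact hle.trans_lt ENNReal.ofReal_lt_top
  · rw [integral_eq_lintegral_of_nonneg_ae (Eventually.of_forall fun _ => sq_nonneg _)
      (hm.pow_const 2).aestronglyMeasurable]
    exact ENNReal.toReal_le_of_le_ofReal hC0 hle

/-- The central limit theorem for finitely many functions of a singular system. -/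
theorem tendsto_integral_normalizedSums {ρ₀ ρ₁ : Measure E} (S : IsSingularSystem ρ₀ ρ₁ k φ ψ s r)
    (π : Measure (E × E)) [IsProbabilityMeasure π] (hfst : MeasurePreserving Prod.fst π ρ₀)
    (hsnd : MeasurePreserving Prod.snd π ρ₁) {t : ι → ℝ} (ht : ∀ i, t i ^ 2 < 1)
    (hπ : ∀ i j, ∫ p, φ i p.1 * ψ j p.2 ∂π = if i = j then t i else 0) (K : Finset ι)
    {h : (K → ℝ × ℝ) → ℝ} (hcont : Continuous h) {C : ℝ} (hbound : ∀ x, |h x| ≤ C) :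
    Tendsto (fun N => ∫ z, h (normalizedSums (fun i : K => φ i) (fun i : K => ψ i) N z)
        ∂(iidLaw π).map (splitSample N)) atTop
      (𝓝 (∫ x, h x ∂Measure.pi fun i : K => correlatedGaussian (t i))) := by
  have h1 : ∀ f : E → ℝ, Measurable f → ∫ p, f p.1 ∂π = ∫ x, f x ∂ρ₀ := fun f hf =>
    integral_comp_measurePreserving hfst hf.aestronglyMeasurable
  have h2 : ∀ f : E → ℝ, Measurable f → ∫ p, f p.2 ∂π = ∫ x, f x ∂ρ₁ := fun f hf =>
    integral_comp_measurePreserving hsnd hf.aestronglyMeasurable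
  refine _root_.tendsto_integral_normalizedSums (K := K) π (φ := fun i : K => φ i)
    (ψ := fun i : K => ψ i) (s := fun i : K => t i) (fun i => ht i)
    (fun i => S.measurable_left i) (fun i => S.measurable_right i)
    (fun i => (S.memLp_left i).comp_measurePreserving hfst)
    (fun i => (S.memLp_right i).comp_measurePreserving hsnd)
    (fun i => (h1 _ (S.measurable_left i)).trans (S.integral_left i))
    (fun i => (h2 _ (S.measurable_right i)).trans (S.integral_right i))
    (fun i j => ?_) (fun i j => ?_) (fun i j => ?_) hcont hbound
  · rw [h1 (fun x => φ i x * φ j x) ((S.measurable_left i).mul (S.measurable_left j)),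
      S.orthonormal_left]
    simp only [Subtype.ext_iff]
  · rw [h2 (fun y => ψ i y * ψ j y) ((S.measurable_right i).mul (S.measurable_right j)),
      S.orthonormal_right]
    simp only [Subtype.ext_iff]
  · rw [hπ]
    simp only [Subtype.ext_iff]

end IsSingularSystem

end SingularSystem

/-! ### The contiguity argument. -/

section Contiguity

variable {E : Type*} [MeasurableSpace E] {ρ₀ ρ₁ : Measure E} [IsProbabilityMeasure ρ₀]
  [IsProbabilityMeasure ρ₁] {k : E × E → ℝ} {ι : Type*} [DecidableEq ι] {φ ψ : ι → E → ℝ}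
  {s : ι → ℝ} {r : ℝ}

theorem integral_withDensity_ofReal {Ω : Type*} [MeasurableSpace Ω] {m : Measure Ω} {k : Ω → ℝ}
    (hk : Measurable k) (hk0 : ∀ z, 0 ≤ k z) (f : Ω → ℝ) :
    ∫ z, f z ∂m.withDensity (fun z => ENNReal.ofReal (k z)) = ∫ z, f z * k z ∂m := by
  rw [integral_withDensity_eq_integral_toReal_smul hk.ennreal_ofReal
    (Eventually.of_forall fun _ => ENNReal.ofReal_lt_top)]
  simp_rw [ENNReal.toReal_ofReal (hk0 _), smul_eq_mul, mul_comm]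

/-- Change of measure: `pairingAverage k N` is the likelihood ratio for nonnegative functions that
do not see the pairing. -/
theorem integral_symmetric_eq {π : Measure (E × E)} [IsProbabilityMeasure π]
    (hπ : π = (ρ₀.prod ρ₁).withDensity fun z => ENNReal.ofReal (k z)) (hkm : Measurable k)
    (hk0 : ∀ z, 0 ≤ k z) (N : ℕ) {G : (Fin N → E) × (Fin N → E) → ℝ} (hG : Measurable G)
    (hG0 : ∀ z, 0 ≤ G z) (hsymm : ∀ x y (σ : Equiv.Perm (Fin N)), G (x, y ∘ σ) = G (x, y)) :
    ∫ z, G z ∂(iidLaw π).map (splitSample N) =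
      ∫ z, G z * pairingAverage k N z ∂samplePair ρ₀ ρ₁ N := by
  have hL := pairingAverage_nonneg hk0 N
  have hLm := measurable_pairingAverage hkm N
  subst hπ
  rw [map_splitSample_withDensity ρ₀ ρ₁ hkm.ennreal_ofReal,
    integral_eq_lintegral_of_nonneg_ae (Eventually.of_forall hG0) hG.aestronglyMeasurable,
    integral_eq_lintegral_of_nonneg_ae (Eventually.of_forall fun z => mul_nonneg (hG0 z) (hL z))
      (hG.mul hLm).aestronglyMeasurable,
    lintegral_withDensity_eq_lintegral_mul _ (by fun_prop) hG.ennreal_ofReal]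
  congr 1
  simp_rw [ENNReal.ofReal_mul (hG0 _)]
  rw [← lintegral_symmetric_mul_prod ρ₀ ρ₁ hkm hk0 N hG.ennreal_ofReal
    fun x y σ => by rw [hsymm]]
  refine lintegral_congr fun z => ?_
  rw [Pi.mul_apply, mul_comm]

/-- The laws of the unordered samples under the product measure are contiguous with respect to
their laws under the coupling of density `k`. -/
theorem IsSingularSystem.tendsto_measureReal_zero [Countable ι]
    (S : IsSingularSystem ρ₀ ρ₁ k φ ψ s r) {π : Measure (E × E)} [IsProbabilityMeasure π]
    (hπ : π = (ρ₀.prod ρ₁).withDensity fun z => ENNReal.ofReal (k z)) (hkm : Measurable k)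
    (hk0 : ∀ z, 0 ≤ k z) (hk : MemLp k 2 (ρ₀.prod ρ₁)) (hfst : π.fst = ρ₀) (hsnd : π.snd = ρ₁)
    {B : ∀ N, Set ((Fin N → E) × (Fin N → E))} (hB : ∀ N, MeasurableSet (B N))
    (hsymm : ∀ N x y (σ : Equiv.Perm (Fin N)), (x, y ∘ σ) ∈ B N ↔ (x, y) ∈ B N)
    (hQ : Tendsto (fun N => ((iidLaw π).map (splitSample N)).real (B N)) atTop (𝓝 0)) :
    Tendsto (fun N => (samplePair ρ₀ ρ₁ N).real (B N)) atTop (𝓝 0) := by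
  have hwd : ∀ f : E × E → ℝ, ∫ z, f z ∂π = ∫ z, f z * k z ∂ρ₀.prod ρ₁ := fun f => by
    rw [hπ, integral_withDensity_ofReal hkm hk0]
  have hk1 : ∫ z, k z ∂ρ₀.prod ρ₁ = 1 := by
    have := hwd fun _ => 1
    simpa using this.symm
  have hs := S.sq_lt_one
  set C := ⨆ K : Finset ι, ∏ i ∈ K, (1 - s i ^ 2)⁻¹ with hC
  set c₀ := (∫ z, k z ^ 2 ∂ρ₀.prod ρ₁ - 1) / (1 - r) + 1 with hc₀
  have hc₀pos : 0 < c₀ := by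
    have h1 := S.sum_sq_div_le ∅
    simp only [Finset.sum_empty] at h1
    linarith
  refine tendsto_order.2 ⟨fun a ha => Eventually.of_forall fun N => ha.trans_le measureReal_nonneg,
    fun ε hε => ?_⟩
  -- The choice gives `log (2 * η)⁻¹ = 4 * c₀ / ε + 1`, so the Gaussian probability that `F ≤ 2 * η`
  -- will be at most `ε / 4`, whatever `K` is.
  obtain ⟨η, hη0, hη1, hη⟩ : ∃ η : ℝ, 0 < η ∧ 2 * η < 1 ∧ c₀ / Real.log (2 * η)⁻¹ ≤ ε / 4 := by
    refine ⟨Real.exp (-(4 * c₀ / ε + 1)) / 2, by positivity, ?_, ?_⟩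
    · rw [mul_div_cancel₀ _ two_ne_zero, Real.exp_lt_one_iff]
      have : 0 < 4 * c₀ / ε := by positivity
      linarith
    · rw [mul_div_cancel₀ _ two_ne_zero, ← Real.exp_neg, Real.log_exp, neg_neg,
        div_le_iff₀ (by positivity)]
      field_simp
      linarith
  -- `τ` is the scale in the inequality `y ≤ τ / 2 + y ^ 2 / (2 * τ)`; with `3 * δ = τ ^ 2` its two
  -- terms contribute `τ / 2` each, hence `ε / 4` in all after division by `η`.
  set τ := η * ε / 4 with hτ
  have hτ0 : 0 < τ := by positivity
  set δ := τ ^ 2 / 3 with hδ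
  have hδ0 : 0 < δ := by positivity
  obtain ⟨K, hK⟩ := exists_lt_of_lt_ciSup (sub_lt_self C hδ0)
  have hsK : ∀ i : K, s i ^ 2 < 1 := fun i => hs i
  obtain ⟨M, hM1, hM⟩ := exists_truncation_mehlerProd hsK hδ0
  let F : (K → ℝ × ℝ) → ℝ := mehlerProd fun i : K => s i
  have hF : Continuous F := continuous_mehlerProd _
  have hF0 : ∀ x, 0 < F x := mehlerProd_pos hsK
  let H : (K → ℝ × ℝ) → ℝ := fun x => min (F x) M
  have hH : Continuous H := hF.min continuous_const
  have hH0 : ∀ x, 0 < H x := fun x => lt_min (hF0 x) (by linarith)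
  have hHM : ∀ x, |H x| ≤ M := fun x => by
    rw [abs_of_pos (hH0 x)]
    exact min_le_right _ _
  -- A continuous cutoff, equal to 1 where `F ≤ η` and to 0 where `F ≥ 2 * η`.
  let h : (K → ℝ × ℝ) → ℝ := fun x => max 0 (min 1 (2 - F x / η))
  have hh : Continuous h := by fun_prop
  have hh1 : ∀ x, |h x| ≤ 1 := fun x => by
    rw [abs_of_nonneg (le_max_left _ _)]
    exact max_le zero_le_one (min_le_left _ _)
  let Z : ∀ N, (Fin N → E) × (Fin N → E) → K → ℝ × ℝ :=
    normalizedSums (fun i : K => φ i) fun i : K => ψ i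
  have hZ : ∀ N, Measurable (Z N) :=
    measurable_normalizedSums (fun i => S.measurable_left i) fun i => S.measurable_right i
  -- limits under the two laws
  have hP : ∀ {g : (K → ℝ × ℝ) → ℝ} {c : ℝ}, Continuous g → (∀ x, |g x| ≤ c) →
      Tendsto (fun N => ∫ z, g (Z N z) ∂samplePair ρ₀ ρ₁ N) atTop
        (𝓝 (∫ x, g x ∂gaussianPairs K)) := fun {g c} hg hgc => by
    -- Under the product law the coordinates are independent, so all the correlations are 0.
    have h1 := S.tendsto_integral_normalizedSums (ρ₀.prod ρ₁) measurePreserving_fst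
      measurePreserving_snd (t := 0) (by simp)
      (fun i j => by
        rw [integral_prod_mul (φ i) (ψ j), S.integral_left]
        simp) K hg hgc
    simpa only [map_splitSample_prod, Pi.zero_apply, correlatedGaussian_zero] using h1
  have hQH := S.tendsto_integral_normalizedSums π ⟨measurable_fst, hfst⟩ ⟨measurable_snd, hsnd⟩ hs
    (fun i j => (hwd _).trans (S.integral_kernel i j)) K hH hHM
  rw [integral_pi_correlatedGaussian hsK] at hQH
  have hP1 := hP hh hh1
  have hP2 := hP (g := fun x => H x ^ 2) (hH.pow 2) (c := M ^ 2) fun x => by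
    rw [abs_pow]
    exact pow_le_pow_left₀ (abs_nonneg _) (hHM x) 2
  have hFint : Integrable F (gaussianPairs K) := (memLp_mehlerProd hsK).integrable one_le_two
  have hlim1 : ∫ x, h x ∂gaussianPairs K ≤ ε / 4 := by
    refine le_trans ?_ ((measureReal_mehlerProd_le hsK (η := 2 * η) (by linarith) hη1).trans
      (le_trans ?_ hη))
    · have hms : MeasurableSet {x | F x ≤ 2 * η} := measurableSet_le hF.measurable measurable_const
      rw [← integral_indicator_one hms]
      refine integral_mono_of_nonneg (Eventually.of_forall fun x => le_max_left _ _)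
        ((integrable_const (1 : ℝ)).indicator hms) (Eventually.of_forall fun x => ?_)
      by_cases hx : F x ≤ 2 * η
      · rw [Set.indicator_of_mem (by exact hx)]
        exact max_le zero_le_one (min_le_left _ _)
      · rw [Set.indicator_of_notMem (by exact hx)]
        refine max_le le_rfl ((min_le_right _ _).trans ?_)
        rw [sub_nonpos, le_div_iff₀ hη0]
        exact (not_le.1 hx).le
    · have hlog : 0 < Real.log (2 * η)⁻¹ :=
        Real.log_pos ((one_lt_inv₀ (by linarith)).2 hη1)
      refine div_le_div_of_nonneg_right ?_ hlog.le
      rw [hc₀, Finset.sum_coe_sort K fun i => s i ^ 2 / (1 - s i ^ 2)]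
      exact add_le_add (S.sum_sq_div_le K) le_rfl
  have hlim2 : ∫ x, H x ^ 2 ∂gaussianPairs K ≤ ∫ x, F x * H x ∂gaussianPairs K := by
    refine integral_mono_of_nonneg (Eventually.of_forall fun x => sq_nonneg _) ?_
      (Eventually.of_forall fun x => ?_)
    · exact hFint.mul_bdd (c := M) hH.aestronglyMeasurable (Eventually.of_forall hHM)
    · simp only [sq]
      exact mul_le_mul_of_nonneg_right (min_le_left _ _) (hH0 x).le
  have hlim3 : C - 2 * δ ≤ ∫ x, H x ^ 2 ∂gaussianPairs K := by
    have h1 : ∏ i : K, (1 - s i ^ 2)⁻¹ = ∏ i ∈ K, (1 - s i ^ 2)⁻¹ :=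
      Finset.prod_coe_sort K fun i => (1 - s i ^ 2)⁻¹
    have h2 : ∏ i : K, (1 - s i ^ 2)⁻¹ - δ ≤ ∫ x, H x ^ 2 ∂gaussianPairs K := hM
    linarith
  have hev1 : ∀ᶠ N in atTop, ∫ z, h (Z N z) ∂samplePair ρ₀ ρ₁ N < 3 * ε / 8 :=
    hP1.eventually (gt_mem_nhds (by linarith))
  -- The limit is `∫ H² - 2 ∫ F H + C ≤ C - ∫ H² ≤ 2 * δ`.
  have hev2 : ∀ᶠ N in atTop, ∫ z, H (Z N z) ^ 2 ∂samplePair ρ₀ ρ₁ N -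
      2 * ∫ z, H (Z N z) ∂(iidLaw π).map (splitSample N) + C < 3 * δ := by
    refine ((hP2.sub (hQH.const_mul 2)).add_const C).eventually (gt_mem_nhds ?_)
    change ∫ x, H x ^ 2 ∂gaussianPairs K - 2 * ∫ x, F x * H x ∂gaussianPairs K + C < 3 * δ
    linarith
  have hev3 : ∀ᶠ N in atTop, ((iidLaw π).map (splitSample N)).real (B N) < η * (ε / 4) :=
    hQ.eventually (gt_mem_nhds (by positivity))
  filter_upwards [hev1, hev2, hev3] with N h1 h2 h3
  set L := pairingAverage k N with hL
  obtain ⟨hL2, hLC⟩ := S.integral_pairingAverage_sq_le hkm hk hk1 N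
  have hLm := measurable_pairingAverage hkm N
  have hLi : Integrable L (samplePair ρ₀ ρ₁ N) := hL2.integrable one_le_two
  have hHm : Measurable fun z => H (Z N z) := hH.measurable.comp (hZ N)
  have hH2 : MemLp (fun z => H (Z N z)) 2 (samplePair ρ₀ ρ₁ N) :=
    MemLp.of_bound hHm.aestronglyMeasurable M (Eventually.of_forall fun z => hHM _)
  have hhi : Integrable (fun z => h (Z N z)) (samplePair ρ₀ ρ₁ N) :=
    Integrable.of_bound (hh.measurable.comp (hZ N)).aestronglyMeasurable 1
      (Eventually.of_forall fun z => hh1 _)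
  have hBL : Integrable (fun z => (B N).indicator 1 z * L z) (samplePair ρ₀ ρ₁ N) := by
    refine (hLi.indicator (hB N)).congr (Eventually.of_forall fun z => ?_)
    by_cases hz : z ∈ B N <;> simp [hz]
  have hQB : ∫ z, (B N).indicator 1 z * L z ∂samplePair ρ₀ ρ₁ N =
      ((iidLaw π).map (splitSample N)).real (B N) := by
    rw [← integral_indicator_one (hB N)]
    refine (integral_symmetric_eq hπ hkm hk0 N (G := (B N).indicator 1)
      (measurable_one.indicator (hB N))
      (fun z => Set.indicator_nonneg (fun _ _ => zero_le_one) z) fun x y σ => ?_).symm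
    by_cases hz : (x, y) ∈ B N
    · rw [Set.indicator_of_mem hz, Set.indicator_of_mem ((hsymm N x y σ).2 hz)]
      rfl
    · rw [Set.indicator_of_notMem hz, Set.indicator_of_notMem (mt (hsymm N x y σ).1 hz)]
  have hQHN : ∫ z, H (Z N z) * L z ∂samplePair ρ₀ ρ₁ N =
      ∫ z, H (Z N z) ∂(iidLaw π).map (splitSample N) :=
    (integral_symmetric_eq hπ hkm hk0 N hHm (fun z => (hH0 _).le) fun x y σ => by
      simp only [Z, normalizedSums_perm]).symm
  have hdiff : ∫ z, (H (Z N z) - L z) ^ 2 ∂samplePair ρ₀ ρ₁ N < 3 * δ := by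
    have e : ∀ z, (H (Z N z) - L z) ^ 2 = H (Z N z) ^ 2 - 2 * (H (Z N z) * L z) + L z ^ 2 :=
      fun z => by ring
    have i1 : Integrable (fun z => 2 * (H (Z N z) * L z)) (samplePair ρ₀ ρ₁ N) :=
      (hH2.integrable_mul hL2).const_mul 2
    have i2 : Integrable (fun z => H (Z N z) ^ 2 - 2 * (H (Z N z) * L z))
      (samplePair ρ₀ ρ₁ N) := hH2.integrable_sq.sub i1
    simp_rw [e]
    rw [integral_add i2 hL2.integrable_sq, integral_sub hH2.integrable_sq i1, integral_const_mul,
      hQHN]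
    linarith
  have hdi : Integrable (fun z => (H (Z N z) - L z) ^ 2) (samplePair ρ₀ ρ₁ N) :=
    (hH2.sub hL2).integrable_sq
  -- On `B N`, either `F ≤ η` and the cutoff is 1, or `H ≥ η` (the truncation level is at least 1)
  -- and `1 ≤ η⁻¹ * (L + (H - L))`, where `H - L` is bounded by the quadratic inequality.
  have hpt : ∀ z, (B N).indicator 1 z ≤ h (Z N z) + η⁻¹ * ((B N).indicator 1 z * L z +
      (τ / 2 + (2 * τ)⁻¹ * (H (Z N z) - L z) ^ 2)) := fun z => by
    have hLz : 0 ≤ L z := pairingAverage_nonneg hk0 N z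
    have hhz : 0 ≤ h (Z N z) := le_max_left _ _
    have hy : H (Z N z) - L z ≤ τ / 2 + (2 * τ)⁻¹ * (H (Z N z) - L z) ^ 2 := by
      have : τ / 2 + (2 * τ)⁻¹ * (H (Z N z) - L z) ^ 2 - (H (Z N z) - L z) =
          (2 * τ)⁻¹ * (H (Z N z) - L z - τ) ^ 2 := by
        field_simp
        ring
      have h4 : 0 ≤ (2 * τ)⁻¹ * (H (Z N z) - L z - τ) ^ 2 := by positivity
      linarith
    by_cases hz : z ∈ B N
    · rw [Set.indicator_of_mem hz, Pi.one_apply, one_mul]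
      by_cases hFz : F (Z N z) ≤ η
      · have h4 : h (Z N z) = 1 := by
          have : 1 ≤ 2 - F (Z N z) / η := by
            have := (div_le_one hη0).2 hFz
            linarith
          simp only [h, min_eq_left this, max_eq_right zero_le_one]
        rw [h4]
        have h5 : 0 ≤ η⁻¹ * (L z + (τ / 2 + (2 * τ)⁻¹ * (H (Z N z) - L z) ^ 2)) := by positivity
        linarith
      · have h4 : η ≤ H (Z N z) := le_min (not_le.1 hFz).le (by linarith)
        have h5 : 1 ≤ η⁻¹ * (L z + (τ / 2 + (2 * τ)⁻¹ * (H (Z N z) - L z) ^ 2)) := by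
          rw [← inv_mul_cancel₀ hη0.ne']
          exact mul_le_mul_of_nonneg_left (by linarith) (inv_nonneg.2 hη0.le)
        linarith
    · rw [Set.indicator_of_notMem hz]
      positivity
  have i3 : Integrable (fun z => τ / 2 + (2 * τ)⁻¹ * (H (Z N z) - L z) ^ 2)
      (samplePair ρ₀ ρ₁ N) := (integrable_const _).add (hdi.const_mul _)
  have i4 : Integrable (fun z => η⁻¹ * ((B N).indicator 1 z * L z +
      (τ / 2 + (2 * τ)⁻¹ * (H (Z N z) - L z) ^ 2))) (samplePair ρ₀ ρ₁ N) :=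
    (hBL.add i3).const_mul _
  calc (samplePair ρ₀ ρ₁ N).real (B N)
      = ∫ z, (B N).indicator 1 z ∂samplePair ρ₀ ρ₁ N := (integral_indicator_one (hB N)).symm
    _ ≤ ∫ z, (h (Z N z) + η⁻¹ * ((B N).indicator 1 z * L z +
          (τ / 2 + (2 * τ)⁻¹ * (H (Z N z) - L z) ^ 2))) ∂samplePair ρ₀ ρ₁ N :=
        integral_mono ((integrable_const (1 : ℝ)).indicator (hB N)) (hhi.add i4) hpt
    _ = ∫ z, h (Z N z) ∂samplePair ρ₀ ρ₁ N +
          η⁻¹ * (((iidLaw π).map (splitSample N)).real (B N) +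
            (τ / 2 + (2 * τ)⁻¹ * ∫ z, (H (Z N z) - L z) ^ 2 ∂samplePair ρ₀ ρ₁ N)) := by
        rw [integral_add hhi i4, integral_const_mul, integral_add hBL i3, hQB,
          integral_add (integrable_const _) (hdi.const_mul _), integral_const_mul]
        simp
    _ < 3 * ε / 8 + η⁻¹ * (η * (ε / 4) + (τ / 2 + (2 * τ)⁻¹ * (3 * δ))) := by
        gcongr
    _ = 7 * ε / 8 := by
        rw [hδ, hτ]
        field_simp
        ring
    _ < ε := by linarith

end Contiguity

/-! ### The marginal conditions in terms of the operator. -/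

section BridgeOperator

variable {α β : Type*} [MeasurableSpace α] [MeasurableSpace β] {μ : Measure α} {ν : Measure β}
  [IsProbabilityMeasure μ] [IsProbabilityMeasure ν]

/-- The second marginal condition says that `∫ k (x, y) μ(dx) = 1` for almost every `y`; it is
checked weakly, against each `g`. -/
theorem kernelOperator_const_of_coupling {k : α × β → ℝ} (hkm : Measurable k) (hk0 : ∀ z, 0 ≤ k z)
    (hk : MemLp k 2 (μ.prod ν))
    (hsnd : ((μ.prod ν).withDensity fun z => ENNReal.ofReal (k z)).snd = ν) :
    kernelOperator k hk (Lp.const 2 μ (1 : ℝ)) = Lp.const 2 ν (1 : ℝ) := by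
  refine ext_inner_right ℝ fun g => ?_
  rw [← integral_mul_kernel, inner_Lp_eq_integral]
  have h1 : ∀ᵐ z ∂μ.prod ν, (Lp.const 2 μ (1 : ℝ)) z.1 = 1 :=
    Measure.quasiMeasurePreserving_fst.ae (Lp.coeFn_const (p := 2) (μ := μ) (1 : ℝ))
  have h2 : ∫ y, (Lp.const 2 ν (1 : ℝ)) y * g y ∂ν = ∫ y, g y ∂ν :=
    integral_congr_ae ((Lp.coeFn_const (p := 2) (μ := ν) (1 : ℝ)).mono fun y hy => by
      simp only [hy, Function.const_apply, one_mul])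
  rw [h2, integral_congr_ae (g := fun z => g z.2 * k z) (h1.mono fun z hz => by
    simp only [hz, one_mul]), ← integral_withDensity_ofReal hkm hk0 fun z => g z.2]
  exact integral_comp_measurePreserving ⟨measurable_snd, hsnd⟩ (Lp.memLp g).1

theorem adjoint_kernelOperator_const_of_coupling {k : α × β → ℝ} (hkm : Measurable k)
    (hk0 : ∀ z, 0 ≤ k z) (hk : MemLp k 2 (μ.prod ν))
    (hfst : ((μ.prod ν).withDensity fun z => ENNReal.ofReal (k z)).fst = μ) :
    (kernelOperator k hk).adjoint (Lp.const 2 ν (1 : ℝ)) = Lp.const 2 μ (1 : ℝ) := by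
  refine ext_inner_left ℝ fun f => ?_
  rw [ContinuousLinearMap.adjoint_inner_right, ← integral_mul_kernel, inner_Lp_eq_integral]
  have h1 : ∀ᵐ z ∂μ.prod ν, (Lp.const 2 ν (1 : ℝ)) z.2 = 1 :=
    Measure.quasiMeasurePreserving_snd.ae (Lp.coeFn_const (p := 2) (μ := ν) (1 : ℝ))
  have h2 : ∫ x, f x * (Lp.const 2 μ (1 : ℝ)) x ∂μ = ∫ x, f x ∂μ :=
    integral_congr_ae ((Lp.coeFn_const (p := 2) (μ := μ) (1 : ℝ)).mono fun x hx => by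
      simp only [hx, Function.const_apply, mul_one])
  rw [h2, integral_congr_ae (g := fun z => f z.1 * k z) (h1.mono fun z hz => by
    simp only [hz, mul_one]), ← integral_withDensity_ofReal hkm hk0 fun z => f z.1]
  exact integral_comp_measurePreserving ⟨measurable_fst, hfst⟩ (Lp.memLp f).1

end BridgeOperator

/-! ### Transfer to the empirical measures, and the theorem. -/

section EmpiricalContiguity

variable {E : Type*} [MeasurableSpace E]

theorem empiricalPairLaw_apply (π : Measure (E × E)) (N : ℕ) {A : Set (Measure E × Measure E)}
    (hA : MeasurableSet A) :
    empiricalPairLaw π N A = (iidLaw π).map (splitSample N) (empiricalOfSplit N ⁻¹' A) := by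
  rw [empiricalPairLaw, Measure.map_apply (measurable_empiricalPair N) hA,
    Measure.map_apply (measurable_splitSample N) (measurable_empiricalOfSplit N hA)]
  rw [← Set.preimage_comp, funext (empiricalPair_eq N)]
  rfl

/-- Events of the empirical pair pull back to sets of samples invariant under permutations of the
second sample, to which the contiguity argument applies. -/
theorem isContiguous_empiricalPairLaw [MeasurableSpace.CountablyGenerated E] {ρ₀ ρ₁ : Measure E}
    [IsProbabilityMeasure ρ₀] [IsProbabilityMeasure ρ₁] {π : Measure (E × E)}
    [IsProbabilityMeasure π] {k : E × E → ℝ}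
    (hπ : π = (ρ₀.prod ρ₁).withDensity fun z => ENNReal.ofReal (k z)) (hkm : Measurable k)
    (hk0 : ∀ z, 0 ≤ k z) (hk : MemLp k 2 (ρ₀.prod ρ₁)) (hfst : π.fst = ρ₀) (hsnd : π.snd = ρ₁)
    (hcompact : IsCompactOperator (kernelOperator k hk))
    (hgap : HasEigenvalueGap ((kernelOperator k hk).adjoint ∘L kernelOperator k hk)
      (Lp.const 2 ρ₀ (1 : ℝ))) :
    IsContiguous (empiricalPairLaw (ρ₀.prod ρ₁)) (empiricalPairLaw π) := by
  classical
  obtain ⟨w, P, φ, ψ, s, r, hc, S⟩ := exists_isSingularSystem hk hcompact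
    (kernelOperator_const_of_coupling hkm hk0 hk (hπ ▸ hsnd))
    (adjoint_kernelOperator_const_of_coupling hkm hk0 hk (hπ ▸ hfst)) hgap
  have := hc
  intro A hA hQ
  simp only [empiricalPairLaw_apply _ _ (hA _)] at hQ ⊢
  have hB := fun N => measurable_empiricalOfSplit N (hA N)
  have key := S.tendsto_measureReal_zero hπ hkm hk0 hk hfst hsnd hB
    (fun N x y σ => by simp only [Set.mem_preimage, empiricalOfSplit_perm])
    ((ENNReal.tendsto_toReal ENNReal.zero_ne_top).comp hQ)
  simp_rw [map_splitSample_prod]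
  exact (ENNReal.tendsto_toReal_iff (fun N => measure_ne_top _ _) ENNReal.zero_ne_top).1 key

theorem measurable_bridgeDensity {c : E → E → ℝ} (hc : Measurable (Function.uncurry c))
    {a b : E → ℝ} (ha : Measurable a) (hb : Measurable b) (ε : ℝ) :
    Measurable (bridgeDensity c ε a b) :=
  (((hc.sub (ha.comp measurable_fst)).sub (hb.comp measurable_snd)).const_mul _).exp

end EmpiricalContiguity

theorem theorem7 {d : ℕ} (c : EuclideanSpace ℝ (Fin d) → EuclideanSpace ℝ (Fin d) → ℝ)
    (ρ₀ ρ₁ : Measure (EuclideanSpace ℝ (Fin d)))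
    [IsProbabilityMeasure ρ₀] [IsProbabilityMeasure ρ₁]
    (hρ₀ : ρ₀ ≪ volume) (hρ₁ : ρ₁ ≪ volume)
    -- the cost function and its growth
    (hc_cont : Continuous (Function.uncurry c))
    (hc_nonneg : ∀ x y, 0 ≤ c x y)
    (hc_zero : ∀ x y, c x y = 0 ↔ x = y)
    (p : ℝ) (hp : 1 ≤ p)
    (hc_growth : ∃ A B M : ℝ, 0 < A ∧ 0 < B ∧
      ∀ x y, M ≤ ‖x‖ → M ≤ ‖y‖ → c x y ≤ A + B * (‖x‖ ^ p + ‖y‖ ^ p))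
    -- moments of the marginals
    (hmom₀ : Integrable (fun x => ‖x‖ ^ p) ρ₀) (hmom₁ : Integrable (fun y => ‖y‖ ^ p) ρ₁)
    -- the Schrödinger bridge and its potentials
    (ε : ℝ) (hε : 0 < ε) (a b : EuclideanSpace ℝ (Fin d) → ℝ)
    (μ : Measure (EuclideanSpace ℝ (Fin d) × EuclideanSpace ℝ (Fin d))) [IsProbabilityMeasure μ]
    (hμ : IsSchrodingerBridge c ε ρ₀ ρ₁ a b μ)
    (ha : Integrable a ρ₀) (hb : Integrable b ρ₁)
    -- square integrability, compactness and spectral gap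
    (hξ : MemLp (bridgeDensity c ε a b) 2 (ρ₀.prod ρ₁))
    (hcompact : IsCompactOperator (kernelOperator (bridgeDensity c ε a b) hξ))
    (hgap₀ : HasEigenvalueGap
      ((kernelOperator (bridgeDensity c ε a b) hξ).adjoint ∘L
        kernelOperator (bridgeDensity c ε a b) hξ) (Lp.const 2 ρ₀ (1 : ℝ)))
    (hgap₁ : HasEigenvalueGap
      (kernelOperator (bridgeDensity c ε a b) hξ ∘L
        (kernelOperator (bridgeDensity c ε a b) hξ).adjoint) (Lp.const 2 ρ₁ (1 : ℝ))) :
    IsContiguous (empiricalPairLaw (ρ₀.prod ρ₁)) (empiricalPairLaw μ) ∧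
    ∀ A : ℕ → Set (ℕ → EuclideanSpace ℝ (Fin d) × EuclideanSpace ℝ (Fin d)),
      (∀ N, MeasurableSet[empiricalSigma (EuclideanSpace ℝ (Fin d)) N] (A N)) →
      Tendsto (fun N => iidLaw μ (A N)) atTop (𝓝 0) →
      Tendsto (fun N => iidLaw (ρ₀.prod ρ₁) (A N)) atTop (𝓝 0) := by
  have hcont := isContiguous_empiricalPairLaw hμ.eq_withDensity
    (measurable_bridgeDensity hc_cont.measurable hμ.measurable_left hμ.measurable_right ε)
    (fun z => (Real.exp_pos _).le) hξ hμ.fst_eq hμ.snd_eq hcompact hgap₀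
  refine ⟨hcont, fun A hA hQ => ?_⟩
  -- Events of the generated σ-algebra are preimages of measurable sets of pairs of measures, so the
  -- explicit form follows from contiguity of the laws.
  choose B hB hAB using hA
  have h : ∀ (π : Measure (EuclideanSpace ℝ (Fin d) × EuclideanSpace ℝ (Fin d))) N,
      iidLaw π (A N) = empiricalPairLaw π N (B N) := fun π N => by
    rw [empiricalPairLaw, Measure.map_apply (measurable_empiricalPair N) (hB N), hAB N]
  simp only [h] at hQ ⊢
  exact hcont B hB hQ
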